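/- Let $(\mathbb W,\circ)$ be a nonzero finite-dimensional Euclidean Jordan algebra with identity $e$ (a real vector space with a bilinear commutative product satisfying $x^2\circ(x\circ y)=x\circ(x^2\circ y)$ and an inner product satisfying $\langle x,y\circ z\rangle=\langle x\circ y,z\rangle$). Let $\mathcal K_2=\{x\circ x:x\in\mathbb W\}$ be its symmetric cone of squares; every symmetric cone arises in this way. Let $r$ be the rank of $\mathbb W$, i.e. the largest degree of an element, where $\deg x$ is the least $k\ge1$ such that $e,x,\dots,x^k$ are linearly dependent. Let $\operatorname{tr}(x)=a_1(x)$ and $\det(x)=a_r(x)$, where $a_i$ is the homogeneous polynomial of degree $i$ on $\mathbb W$ such that $x^r-a_1(x)x^{r-1}+\dots+(-1)^ra_r(x)e=0$ for all $x$. Let $x^{-1}$ denote the Jordan inverse, and set $f(y)=r^{-1}\ln\det(y)$. (a) For every $y\in\operatorname{int}\mathcal K_2$ one has $\det(y)>0$, $f$ is differentiable at $y$, and $\langle\nabla f(y),w\rangle=r^{-1}\operatorname{tr}(y^{-1}\circ w)$ for all $w\in\mathbb W$ (so $\nabla f(y)=r^{-1}y^{-1}$ with respect to the inner product $\operatorname{tr}(x\circ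 y)$). (b) For every $w\in\mathcal K_2\setminus\{0\}$, the numbers $\langle\nabla f(y),w\rangle$ and $\operatorname{tr}(y^{-1}\circ w)$ are positive for all $y\in\operatorname{int}\mathcal K_2$, and the functions $$\psi_w(y)=\ln\langle\nabla f(y),w\rangle\quad\text{and}\quad y\mapsto\ln\operatorname{tr}(y^{-1}\circ w)=\psi_w(y)+\ln r$$ are convex on $\operatorname{int}\mathcal K_2$. (For $w=0$ both arguments of $\ln$ vanish identically, and the claim is trivial.) (c) Call a real function $F$, differentiable on $\mathbb R^n_{++}=\operatorname{int}\mathbb R^n_+$, gradient log-convex (over $\mathcal K_1=\mathbb R_+^n$) if $\nabla F(x)\in\mathbb R^n_{++}$ for all $x\in\mathbb R^n_{++}$ and $$\lambda\ln\nabla_iF(x)+(1-\lambda)\ln\nabla_iF(y)\ \ge\ \ln\nabla_iF(\lambda x+(1-\lambda)y)$$ for all $i$, all $\lambda\in[0,1]$ and all $x,y\in\mathbb R^n_{++}$ whose coordinates sum to $1$. Let $A:\mathbb R^n\to\mathbb W$ be linear with $A(\mathbb R^n_+)\subseteq\mathcal K_2$, $A(\mathbb R^n_{++})\subseteq\operatorname{int}\mathcal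 K_2$ and $A^*(\operatorname{int}\mathcal K_2^*)\subseteq\mathbb R^n_{++}$, where $\mathcal K_2^*$ is the dual cone of $\mathcal K_2$. Then $F(x)=f(Ax)$ is gradient log-convex. (d) (Positron emission tomography.) Let $p_{ij}\ge0$ and $Y_j\ge0$ ($i\in[n]$, $j\in[m]$) be such that for each $j$ some $p_{ij}>0$, and for each $i$ some $Y_jp_{ij}>0$ (for instance, all $Y_j>0$ and $\sum_jp_{ij}=1$ for every $i$). Then $F(z)=\big(\sum_{j}Y_j\big)^{-1}\sum_{j}Y_j\ln\big(\sum_{i}p_{ij}z_i\big)$ is gradient log-convex. (e) ($D$-optimal design.) Let $a_1,\dots,a_m\in\mathbb R^n$ be nonzero vectors that span $\mathbb R^n$ (for instance, nonzero vectors whose affine hull is $\mathbb R^n$). Then $F(x)=n^{-1}\ln\det\big(\sum_{i=1}^mx_ia_ia_i^\top\big)$ is gradient log-convex. -/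

import Mathlib

open scoped Gradient

noncomputable section

/-- A Euclidean Jordan algebra structure on the real inner product space `W`: a bilinear
commutative product with identity satisfying the Jordan identity, for which the inner product of
`W` is associative. -/
structure EuclideanJordanAlgebra (W : Type*) [NormedAddCommGroup W] [InnerProductSpace ℝ W] where
  /-- the Jordan product -/
  mul : W →ₗ[ℝ] W →ₗ[ℝ] W
  /-- the identity element -/
  one : W
  mul_comm : ∀ x y, mul x y = mul y x
  jordan : ∀ x y, mul (mul x x) (mul x y) = mul x (mul (mul x x) y)
  mul_one : ∀ x, mul x one = x
  inner_assoc : ∀ x y z, inner ℝ x (mul y z) = inner ℝ (mul x y) z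

namespace EuclideanJordanAlgebra

variable {W : Type*} [NormedAddCommGroup W] [InnerProductSpace ℝ W] (E : EuclideanJordanAlgebra W)

/-- Powers: `x ^ 0 = e` and `x ^ (k + 1) = x ∘ x ^ k`. -/
def pow (x : W) : ℕ → W
  | 0 => E.one
  | k + 1 => E.mul x (pow x k)

/-- The degree of `x`: the least `k ≥ 1` such that `e, x, …, x ^ k` are linearly dependent. -/
def deg (x : W) : ℕ :=
  sInf {k : ℕ | 0 < k ∧ ¬ LinearIndependent ℝ (fun i : Fin (k + 1) => E.pow x i)}

/-- The rank: the largest degree of an element (degrees are bounded in finite dimension). -/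
def rank : ℕ := sSup (Set.range E.deg)

/-- The value at `x` of a polynomial in the coordinates of `x` in a fixed basis of `W`. -/
def evalAt (x : W) (p : MvPolynomial (Fin (Module.finrank ℝ W)) ℝ) [FiniteDimensional ℝ W] : ℝ :=
  MvPolynomial.eval (fun j => (Module.finBasis ℝ W).repr x j) p

/-- `a 1, …, a r` are the coefficients of the characteristic polynomial: `a i` is a homogeneous
polynomial of degree `i` on `W`, and `x ^ r - a₁(x) x ^ (r - 1) + ⋯ + (-1) ^ r a_r(x) e = 0` for
all `x`. (At an `x` of degree `r` this determines the values `a i (x)`, and such `x` are dense, so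
there is only one such family.) -/
def IsCharCoeffs [FiniteDimensional ℝ W]
    (a : ℕ → MvPolynomial (Fin (Module.finrank ℝ W)) ℝ) : Prop :=
  a 0 = 1 ∧ (∀ i, (a i).IsHomogeneous i) ∧ (∀ i, E.rank < i → a i = 0) ∧
    ∀ x : W, ∑ i ∈ Finset.range (E.rank + 1),
      ((-1 : ℝ) ^ i * evalAt x (a i)) • E.pow x (E.rank - i) = 0

open Classical in
/-- The family of coefficients of the characteristic polynomial. -/
def charCoeffs [FiniteDimensional ℝ W] : ℕ → MvPolynomial (Fin (Module.finrank ℝ W)) ℝ :=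
  if h : ∃ a, E.IsCharCoeffs a then h.choose else 0

/-- The trace `tr x = a₁(x)`, the sum of the eigenvalues of `x`. -/
def tr [FiniteDimensional ℝ W] (x : W) : ℝ := evalAt x (E.charCoeffs 1)

/-- The determinant `det x = a_r(x)`, the product of the eigenvalues of `x`. -/
def det [FiniteDimensional ℝ W] (x : W) : ℝ := evalAt x (E.charCoeffs E.rank)

open Classical in
/-- The inverse of `x`: the element `y` of the subalgebra generated by `x` (the span of the powers
of `x`) with `x ∘ y = e`. It is unique, since that subalgebra is associative. If
`x = ∑ λᵢ qᵢ` for a Jordan frame `qᵢ` and nonzero `λᵢ`, it is `∑ λᵢ⁻¹ qᵢ`. The value is `0` if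
there is no such `y`. -/
def inv (x : W) : W :=
  if h : ∃ y ∈ Submodule.span ℝ (Set.range (E.pow x)), E.mul x y = E.one then h.choose else 0

/-- The cone of squares. -/
def cone : Set W := Set.range (fun x => E.mul x x)

/-- The rank-normalized log-determinant `r⁻¹ ln det y`. -/
def logDet [FiniteDimensional ℝ W] (y : W) : ℝ := (E.rank : ℝ)⁻¹ * Real.log (E.det y)

end EuclideanJordanAlgebra

/-- Gradient log-convexity over `K₁ = ℝ₊ⁿ`, where `ln` of a vector and the order are taken
coordinatewise: `∇F` maps the interior of `ℝ₊ⁿ` into itself, and `ln ∇F` is convex on the relative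
interior of the unit simplex. -/
def GradientLogConvex {n : ℕ} (F : EuclideanSpace ℝ (Fin n) → ℝ) : Prop :=
  (∀ x : EuclideanSpace ℝ (Fin n), (∀ i, 0 < x i) →
    DifferentiableAt ℝ F x ∧ ∀ i, 0 < (∇ F x) i) ∧
  ∀ x y : EuclideanSpace ℝ (Fin n), (∀ i, 0 < x i) → ∑ i, x i = 1 → (∀ i, 0 < y i) →
    ∑ i, y i = 1 → ∀ t : ℝ, 0 ≤ t → t ≤ 1 → ∀ i,
      Real.log ((∇ F (t • x + (1 - t) • y)) i) ≤
        t * Real.log ((∇ F x) i) + (1 - t) * Real.log ((∇ F y) i)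

/-- The objective of the positron emission tomography problem with counts `Y j` and detection
probabilities `p i j`. -/
def petObjective {n m : ℕ} (p : Fin n → Fin m → ℝ) (Y : Fin m → ℝ)
    (z : EuclideanSpace ℝ (Fin n)) : ℝ :=
  (∑ j, Y j)⁻¹ * ∑ j, Y j * Real.log (∑ i, p i j * z i)

/-- The objective of the D-optimal design problem with points `a i` in `ℝⁿ`. -/
def dOptObjective {n m : ℕ} (a : Fin m → Fin n → ℝ) (x : EuclideanSpace ℝ (Fin m)) : ℝ :=
  (n : ℝ)⁻¹ * Real.log (Matrix.det (∑ i, x i • Matrix.vecMulVec (a i) (a i)))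

end

/-! The heart is convexity of `y ↦ ln tr(y⁻¹ ∘ w)` on the interior of the cone. Write `y = ∑ μⱼ cⱼ`
in a frame, i.e. `r` orthogonal nonzero idempotents with sum `e`. Then `det y = ∏ μⱼ`, and `tr(y⁻¹ ∘
w) = ∑ wⱼ / μⱼ`, where `wⱼ = ⟨w, cⱼ⟩ / ‖cⱼ‖²` is nonnegative for `w` in the cone
(`IsFrame.tr_inv_combo_mul`). Along a segment from `e` to `y` the frame is fixed and the eigenvalues
are affine, so convexity is Hölder's inequality for sums of reciprocals (`Real.log_sum_div_le`).

An arbitrary segment is moved to one starting at `e` by `exp(L_a)`, with `L_a` the multiplication by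
`a`. This map preserves the cone, multiplies `det` by the constant `exp(tr a)`, and sends `e` to any
prescribed interior point. As `tr(y⁻¹ ∘ w)` is the logarithmic derivative of `det` at `y` along `w`,
it is invariant when `y` and `w` are moved together (`tr_inv_mul_expMul`).

The frame formulas rest on the characteristic identity. Its coefficients come from the minimal
polynomial of the generic element, made homogeneous by scaling. Frames exist at regular elements by
the spectral theorem and elsewhere by compactness (`exists_isFrame`). Differentiating the identity,
pairing it with each `cⱼ` and interpolating at distinct eigenvalues gives `tr`, `det` and the
derivative of `det`.

The pullback by `A` has partial derivatives `⟨∇f(Ax), A eᵢ⟩` with `A eᵢ` in the cone. The two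
applications are proved directly: tomography from the same Hölder inequality, D-optimality from
concavity of `A ↦ (uᵀ A⁻¹ u)⁻¹`. -/

namespace EuclideanJordanAlgebra

/-! ### Jordan identities, power associativity and the spectral theorem -/

variable {W : Type*} [NormedAddCommGroup W] [InnerProductSpace ℝ W] (E : EuclideanJordanAlgebra W)

/-- The full linearization of the Jordan identity. -/
theorem jordan_linearized (a b c y : W) :
    E.mul (E.mul a b) (E.mul c y) + E.mul (E.mul b c) (E.mul a y) + E.mul (E.mul c a) (E.mul b y) =
      E.mul c (E.mul (E.mul a b) y) + E.mul a (E.mul (E.mul b c) y) +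
        E.mul b (E.mul (E.mul c a) y) := by
  have h0 := E.jordan (a + b + c) y
  have h1 := E.jordan (a + b) y
  have h2 := E.jordan (b + c) y
  have h3 := E.jordan (c + a) y
  have h4 := E.jordan a y
  have h5 := E.jordan b y
  have h6 := E.jordan c y
  simp only [map_add, LinearMap.add_apply, E.mul_comm b a, E.mul_comm c b, E.mul_comm a c]
    at h0 h1 h2 h3
  linear_combination (norm := module) (1 / 2 : ℝ) • (h0 - h1 - h2 - h3 + h4 + h5 + h6)

/-- The left side of the linearized identity is unchanged when `c` and `y` are exchanged, so the two
right sides agree. This expresses multiplication by a triple product through multiplications by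
shorter products. -/
theorem mul_mul_mul_apply (a b c y : W) :
    E.mul (E.mul (E.mul a b) c) y =
      E.mul c (E.mul (E.mul a b) y) + E.mul a (E.mul (E.mul b c) y) + E.mul b (E.mul (E.mul c a) y)
        - E.mul a (E.mul c (E.mul b y)) - E.mul b (E.mul c (E.mul a y)) := by
  have h1 := E.jordan_linearized a b c y
  have h2 := E.jordan_linearized a b y c
  rw [E.mul_comm y c, E.mul_comm y a, E.mul_comm a c, E.mul_comm (E.mul b y) (E.mul c a),
    E.mul_comm (E.mul a y) (E.mul b c), E.mul_comm y (E.mul (E.mul a b) c),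
    E.mul_comm (E.mul b y) c, E.mul_comm (E.mul a y) c] at h2
  linear_combination (norm := module) h1 - h2

theorem one_mul (x : W) : E.mul E.one x = x := by rw [E.mul_comm, E.mul_one]

theorem inner_mul_left (x y z : W) : inner ℝ (E.mul x y) z = inner ℝ y (E.mul x z) := by
  rw [E.mul_comm, E.inner_assoc]

theorem inner_mul_right (x y z : W) : inner ℝ y (E.mul x z) = inner ℝ (E.mul x y) z :=
  (E.inner_mul_left x y z).symm

theorem pow_succ_eq (x : W) (k : ℕ) : E.pow x (k + 1) = E.mul x (E.pow x k) := rfl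

theorem pow_one_eq (x : W) : E.pow x 1 = x := E.mul_one x

/-- Multiplications by powers of `x` commute with those by `x` and by `x ∘ x`. -/
theorem pow_mul_comm (x : W) (n : ℕ) : ∀ y,
    E.mul (E.pow x n) (E.mul x y) = E.mul x (E.mul (E.pow x n) y) ∧
    E.mul (E.pow x n) (E.mul (E.mul x x) y) = E.mul (E.mul x x) (E.mul (E.pow x n) y) := by
  induction n using Nat.strong_induction_on with
  | _ n ih =>
    match n, ih with
    | 0, _ => intro y; simp [pow, one_mul]
    | 1, _ => intro y; rw [pow_one_eq]; exact ⟨rfl, (E.jordan x y).symm⟩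
    | n + 2, ih =>
      intro y
      -- The triple `x, xⁿ, x` gives a recursion that places every `L_{xⁿ}` in the algebra generated
      -- by the commuting operators `L_x` and `L_{x²}`.
      have key : ∀ z, E.mul (E.pow x (n + 2)) z =
          E.mul x (E.mul (E.pow x (n + 1)) z) + E.mul x (E.mul (E.pow x (n + 1)) z)
            + E.mul (E.pow x n) (E.mul (E.mul x x) z) - E.mul x (E.mul x (E.mul (E.pow x n) z))
            - E.mul (E.pow x n) (E.mul x (E.mul x z)) := by
        intro z
        have h := E.mul_mul_mul_apply x (E.pow x n) x z
        rw [← pow_succ_eq, E.mul_comm (E.pow x n) x, ← pow_succ_eq,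
          E.mul_comm (E.pow x (n + 1)) x, ← pow_succ_eq] at h
        exact h
      have i0 := ih n (by omega)
      have i1 := ih (n + 1) (by omega)
      have j := E.jordan x
      constructor
      · simp only [key, map_add, map_sub, (i0 _).1, (i1 _).1, j, (i0 _).2]
      · simp only [key, map_add, map_sub, (i0 _).1, j, (i0 _).2, (i1 _).2]

/-- Power associativity. -/
theorem pow_mul_pow (x : W) (m n : ℕ) : E.mul (E.pow x m) (E.pow x n) = E.pow x (m + n) := by
  induction n with
  | zero => exact E.mul_one _
  | succ n ih => rw [pow_succ_eq, (E.pow_mul_comm x m _).1, ih]; rfl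

/-- Multiplication by an idempotent is positive semidefinite. -/
theorem inner_idem_mul_nonneg {c : W} (hc : E.mul c c = c) (x : W) :
    0 ≤ inner ℝ (E.mul c x) x := by
  -- `L_c` is a root of `t (t - 1) (2t - 1)`, so its eigenvalues lie in `{0, 1/2, 1}`.
  have key : ∀ z, E.mul c z = (3 : ℝ) • E.mul c (E.mul c z) -
      (2 : ℝ) • E.mul c (E.mul c (E.mul c z)) := by
    intro z
    have h := E.mul_mul_mul_apply c c c z
    simp only [hc] at h
    linear_combination (norm := module) (1 : ℝ) • h
  set y := E.mul c x with hy
  set z := E.mul c y with hz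
  have h3 : E.mul c z = (1 / 2 : ℝ) • ((3 : ℝ) • z - y) := by
    have := key x
    rw [← hy, ← hz] at this
    linear_combination (norm := module) (1 / 2 : ℝ) • this
  have a1 : inner ℝ y y = inner ℝ z x := (E.inner_mul_left c y x).symm
  have a2 : inner ℝ z y = inner ℝ (E.mul c z) x := (E.inner_mul_left c z x).symm
  have a3 : inner ℝ z z = inner ℝ (E.mul c (E.mul c z)) x :=
    ((E.inner_mul_left c _ x).trans (E.inner_mul_left c z y)).symm
  have h4 : E.mul c (E.mul c z) = (1 / 2 : ℝ) • ((3 : ℝ) • E.mul c z - z) := by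
    conv_lhs => rw [h3]
    simp only [map_smul, map_sub, ← hz]
  -- On `{0, 1/2, 1}` one has `t = 8 (t - t²)² + (2t² - t)²`, hence `⟨c ∘ x, x⟩ = 8 ‖y - z‖² + ‖2z -
  -- y‖²`.
  have s1 := real_inner_self_nonneg (x := y - z)
  have s2 := real_inner_self_nonneg (x := (2 : ℝ) • z - y)
  rw [h4, h3] at a3
  rw [h3] at a2
  simp only [inner_sub_left, inner_sub_right, inner_smul_left, inner_smul_right,
    real_inner_comm z y, RCLike.conj_to_real] at *
  nlinarith

/-- Evaluation of a real polynomial at an element. -/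
def polyEval (x : W) (p : Polynomial ℝ) : W := p.sum fun k a => a • E.pow x k

theorem pow_eq_iterate (x : W) (k : ℕ) : E.pow x k = ((E.mul x) ^ k) E.one := by
  induction k with
  | zero => rfl
  | succ k ih => rw [pow_succ_eq, ih, pow_succ', Module.End.mul_apply]

theorem polyEval_eq_aeval (x : W) (p : Polynomial ℝ) :
    E.polyEval x p = Polynomial.aeval (E.mul x) p E.one := by
  rw [polyEval, Polynomial.aeval_eq_sum_range, Polynomial.sum_over_range _ (by simp)]
  simp [pow_eq_iterate, LinearMap.sum_apply]

theorem polyEval_add (x : W) (p q : Polynomial ℝ) :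
    E.polyEval x (p + q) = E.polyEval x p + E.polyEval x q := by
  simp [polyEval_eq_aeval]

theorem polyEval_monomial (x : W) (n : ℕ) (a : ℝ) :
    E.polyEval x (Polynomial.monomial n a) = a • E.pow x n := by
  simp [polyEval, Polynomial.sum_monomial_index]

/-- Power associativity on monomials, extended bilinearly. Products inside the subalgebra generated
by `x` thus become products of polynomials. -/
theorem polyEval_mul (x : W) (p q : Polynomial ℝ) :
    E.polyEval x (p * q) = E.mul (E.polyEval x p) (E.polyEval x q) := by
  induction p using Polynomial.induction_on' with
  | add p p' hp hp' => simp [add_mul, polyEval_add, hp, hp']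
  | monomial n a =>
    induction q using Polynomial.induction_on' with
    | add p p' hp hp' => simp only [mul_add, polyEval_add, hp, hp', map_add]
    | monomial m b =>
      simp [Polynomial.monomial_mul_monomial, polyEval_monomial, pow_mul_pow, smul_smul]
      rw [_root_.mul_comm]

theorem polyEval_mem_span (x : W) (p : Polynomial ℝ) :
    E.polyEval x p ∈ Submodule.span ℝ (Set.range (E.pow x)) :=
  Submodule.sum_mem _ fun k _ => Submodule.smul_mem _ _ (Submodule.subset_span ⟨k, rfl⟩)

/-- The spectral theorem: `x = ∑ μ_λ c_λ` for a complete family of orthogonal idempotents in the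
subalgebra generated by `x`, with distinct coefficients. -/
theorem exists_spectral [FiniteDimensional ℝ W] (x : W) :
    ∃ (s : Finset ℝ) (c : ℝ → W), (∀ l ∈ s, c l ≠ 0) ∧ (∑ l ∈ s, c l = E.one) ∧
      (∀ l ∈ s, E.mul x (c l) = l • c l) ∧
      (∀ l ∈ s, ∀ m ∈ s, E.mul (c l) (c m) = if l = m then c l else 0) := by
  classical
  have hsym : (E.mul x).IsSymmetric := fun y z => E.inner_mul_left x y z
  set n := Module.finrank ℝ W
  let b := hsym.eigenvectorBasis (n := n) rfl
  let ev := hsym.eigenvalues (n := n) rfl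
  -- `c l` is the component of `e` in the `l`-eigenspace of `L_x`.
  let c : ℝ → W := fun l => ∑ i with ev i = l, (inner ℝ (b i) E.one) • b i
  let S := Finset.univ.image ev
  have hone : ∑ l ∈ S, c l = E.one := by
    rw [Finset.sum_fiberwise_of_maps_to (fun i _ => Finset.mem_image_of_mem _ (Finset.mem_univ i))]
    exact b.sum_repr' E.one
  have hmulc : ∀ l, E.mul x (c l) = l • c l := by
    intro l
    simp only [c, map_sum, map_smul, Finset.smul_sum]
    refine Finset.sum_congr rfl fun i hi => ?_
    have h1 : E.mul x (b i) = ev i • b i := hsym.apply_eigenvectorBasis rfl i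
    rw [h1, (Finset.mem_filter.1 hi).2, smul_comm]
  have hae : ∀ (p : Polynomial ℝ) l, Polynomial.aeval (E.mul x) p (c l) = p.eval l • c l := by
    intro p l
    induction p using Polynomial.induction_on' with
    | add p p' hp hp' => simp [hp, hp', add_smul]
    | monomial n a =>
      have : ∀ n : ℕ, ((E.mul x) ^ n) (c l) = l ^ n • c l := by
        intro n
        induction n with
        | zero => simp
        | succ n ih =>
          rw [pow_succ', Module.End.mul_apply, ih, map_smul, hmulc, smul_smul, pow_succ]
      simp [Polynomial.aeval_monomial, this, smul_smul, _root_.mul_comm]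
  have hpe : ∀ p : Polynomial ℝ, E.polyEval x p = ∑ l ∈ S, p.eval l • c l := by
    intro p
    rw [polyEval_eq_aeval, ← hone, map_sum]
    exact Finset.sum_congr rfl fun l _ => hae p l
  -- Being a polynomial in `x`, each component acts on the others through `L_x`, by a scalar that is
  -- 0 or 1.
  have hbas : ∀ l ∈ S, E.polyEval x (Lagrange.basis S id l) = c l := by
    intro l hl
    rw [hpe, Finset.sum_eq_single l]
    · have := Lagrange.eval_basis_self (s := S) (v := (id : ℝ → ℝ)) Function.injective_id.injOn hl
      simp only [id] at this
      rw [this, one_smul]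
    · intro m hm hml
      have := Lagrange.eval_basis_of_ne (s := S) (v := (id : ℝ → ℝ)) hml.symm hm
      simp only [id] at this
      rw [this, zero_smul]
    · exact fun h => absurd hl h
  refine ⟨S.filter (fun l => c l ≠ 0), c, fun l hl => (Finset.mem_filter.1 hl).2, ?_,
    fun l _ => hmulc l, ?_⟩
  · rw [← hone, Finset.sum_filter_ne_zero]
  · intro l hl m hm
    have hl := (Finset.mem_filter.1 hl).1
    have hm := (Finset.mem_filter.1 hm).1
    conv_lhs => rw [← hbas l hl, ← hbas m hm]
    rw [← polyEval_mul, polyEval_eq_aeval, Polynomial.aeval_mul, Module.End.mul_apply,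
      ← polyEval_eq_aeval, hbas m hm, hae]
    split_ifs with h
    · subst h
      have := Lagrange.eval_basis_self (s := S) (v := (id : ℝ → ℝ)) Function.injective_id.injOn hl
      simp only [id] at this
      rw [this, one_smul]
    · have := Lagrange.eval_basis_of_ne (s := S) (v := (id : ℝ → ℝ)) h hm
      simp only [id] at this
      rw [this, zero_smul]

end EuclideanJordanAlgebra

/-! ### Minimal polynomials of vectors and evaluation of homogeneous polynomials -/

open Polynomial in
/-- The minimal polynomial of a vector under a matrix over an integrally closed domain has
coefficients in that domain; a matrix `N` with cleared denominators witnesses that the vectors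
`M ^ l v` of lower degree are independent. -/
theorem Matrix.exists_minpoly_vector {R ι : Type*} [CommRing R] [IsDomain R] [IsIntegrallyClosed R]
    [Fintype ι] [DecidableEq ι] (M : Matrix ι ι R) (v : ι → R) :
    ∃ q : R[X], q.Monic ∧ (∑ k ∈ Finset.range (q.natDegree + 1), q.coeff k • (M ^ k).mulVec v) = 0 ∧
      ∃ (N : Fin q.natDegree → ι → R) (s : R), s ≠ 0 ∧
        ∀ k l : Fin q.natDegree, ∑ i, N k i * ((M ^ (l : ℕ)).mulVec v) i = if k = l then s else 0 := by
  classical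
  let K := FractionRing R
  let φ := algebraMap R K
  have hφ : Function.Injective φ := IsFractionRing.injective R K
  let MK : Matrix ι ι K := M.map φ
  let vK : ι → K := fun i => φ (v i)
  have hpow : ∀ k, (MK ^ k).mulVec vK = fun i => φ ((M ^ k).mulVec v i) := by
    intro k
    have h1 : MK ^ k = (M ^ k).map φ := (Matrix.map_pow (f := φ) M k).symm
    funext i
    rw [h1, RingHom.map_mulVec]
    rfl
  -- The annihilator of `v` over the fraction field. By Cayley–Hamilton its generator divides the
  -- characteristic polynomial, and integral closedness brings its monic associate back to `R`.
  let I : Ideal K[X] :=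
    { carrier := {p | (aeval MK p).mulVec vK = 0}
      add_mem' := by
        intro a b ha hb
        simp only [Set.mem_ofPred_eq] at *
        rw [map_add, Matrix.add_mulVec, ha, hb, add_zero]
      zero_mem' := by simp
      smul_mem' := by
        intro a b hb
        simp only [Set.mem_ofPred_eq, smul_eq_mul] at *
        rw [map_mul, ← Matrix.mulVec_mulVec, hb, Matrix.mulVec_zero] }
  have hI : ∀ p : K[X], p ∈ I ↔ (aeval MK p).mulVec vK = 0 := fun p => Iff.rfl
  have haev : ∀ p : K[X], (aeval MK p).mulVec vK =
      ∑ k ∈ Finset.range (p.natDegree + 1), p.coeff k • (MK ^ k).mulVec vK := by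
    intro p
    rw [Polynomial.aeval_eq_sum_range, Matrix.sum_mulVec]
    simp [Matrix.smul_mulVec]
  set g := Submodule.IsPrincipal.generator I with hg
  have hgI : ∀ p, p ∈ I ↔ g ∣ p := fun p => Submodule.IsPrincipal.mem_iff_generator_dvd I
  have hchar : g ∣ M.charpoly.map φ := by
    rw [← hgI, hI, ← Matrix.charpoly_map]
    rw [show M.map φ = MK from rfl, Matrix.aeval_self_charpoly, Matrix.zero_mulVec]
  have g0 : g ≠ 0 := ne_zero_of_dvd_ne_zero ((M.charpoly_monic.map φ).ne_zero) hchar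
  obtain ⟨q, hq⟩ := IsIntegrallyClosed.eq_map_mul_C_of_dvd K M.charpoly_monic hchar
  have hlc : g.leadingCoeff ≠ 0 := leadingCoeff_ne_zero.2 g0
  have hqm : q.Monic := by
    refine Polynomial.monic_of_injective hφ ?_
    have := congrArg leadingCoeff hq
    rw [leadingCoeff_mul, leadingCoeff_C] at this
    exact mul_right_cancel₀ hlc (this.trans (_root_.one_mul _).symm)
  have hqI : q.map φ ∈ I := by
    rw [hgI, ← hq]
    exact (associated_mul_unit_left _ _ (isUnit_C.2 (isUnit_iff_ne_zero.2 hlc))).dvd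
  have hdeg : (q.map φ).natDegree = q.natDegree := hqm.natDegree_map φ
  refine ⟨q, hqm, ?_, ?_⟩
  · have h := (hI _).1 hqI
    rw [haev, hdeg] at h
    funext i
    apply hφ
    have h2 := congrFun h i
    simp only [Finset.sum_apply, Pi.smul_apply, hpow, coeff_map, smul_eq_mul, Pi.zero_apply] at h2
    simp only [Finset.sum_apply, Pi.smul_apply, smul_eq_mul, map_sum, map_mul, Pi.zero_apply, map_zero]
    exact h2
  · let f : (Fin q.natDegree → K) →ₗ[K] (ι → K) :=
      Fintype.linearCombination K (fun l : Fin q.natDegree => (MK ^ (l : ℕ)).mulVec vK)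
    have hf : LinearMap.ker f = ⊥ := by
      rw [LinearMap.ker_eq_bot']
      intro c hc
      have hc' : ∑ l, c l • (MK ^ (l : ℕ)).mulVec vK = 0 := by
        simpa [f, Fintype.linearCombination_apply] using hc
      let p : K[X] := ∑ l : Fin q.natDegree, monomial (l : ℕ) (c l)
      have hpI : g ∣ p := by
        rw [← hgI, hI]
        simp only [p, map_sum, aeval_monomial, Matrix.sum_mulVec]
        rw [← hc']
        refine Finset.sum_congr rfl fun l _ => ?_
        rw [← Algebra.smul_def, Matrix.smul_mulVec]
      have hpd : p.degree < g.degree := by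
        have h1 : g.degree = (q.natDegree : WithBot ℕ) := by
          rw [← hq, degree_mul, degree_C hlc, add_zero, degree_eq_natDegree (hqm.map φ).ne_zero, hdeg]
        rw [h1]
        refine lt_of_le_of_lt (degree_sum_le _ _) ?_
        rw [Finset.sup_lt_iff (WithBot.bot_lt_coe _)]
        intro l _
        exact lt_of_le_of_lt (degree_monomial_le _ _) (by exact_mod_cast l.2)
      have hp0 : p = 0 := eq_zero_of_dvd_of_degree_lt hpI hpd
      funext k
      have := congrArg (fun r => coeff r (k : ℕ)) hp0
      simp only [p, finsetSum_coeff, coeff_monomial, coeff_zero] at this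
      rw [Finset.sum_eq_single k] at this
      · simpa using this
      · intro b _ hb
        rw [if_neg]
        exact fun h => hb (Fin.ext h)
      · simp
    -- `N` is a left inverse of the matrix with columns `M ^ l v`, multiplied by a common
    -- denominator.
    obtain ⟨h, hh⟩ := f.exists_leftInverse_of_injective hf
    obtain ⟨b, hb⟩ := IsLocalization.exist_integer_multiples_of_finite (nonZeroDivisors R)
      (fun ki : Fin q.natDegree × ι => h (Pi.single ki.2 1) ki.1)
    choose N hN using hb
    refine ⟨fun k i => N (k, i), b, nonZeroDivisors.ne_zero b.2, fun k l => ?_⟩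
    apply hφ
    rw [map_sum]
    have e1 : ∀ i, φ (N (k, i) * ((M ^ (l : ℕ)).mulVec v) i) =
        φ b * (h (Pi.single i 1) k * (MK ^ (l : ℕ)).mulVec vK i) := by
      intro i
      rw [map_mul, hN (k, i), hpow, Algebra.smul_def, mul_assoc]
    rw [Finset.sum_congr rfl fun i _ => e1 i, ← Finset.mul_sum]
    have e2 : h ((MK ^ (l : ℕ)).mulVec vK) = Pi.single l 1 := by
      have := congrArg (fun F => F (Pi.single l 1)) hh
      simpa [f, Fintype.linearCombination_apply, Pi.single_apply] using this
    have e3 : ∑ i, h (Pi.single i 1) k * (MK ^ (l : ℕ)).mulVec vK i =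
        h ((MK ^ (l : ℕ)).mulVec vK) k := by
      conv_rhs => rw [pi_eq_sum_univ' ((MK ^ (l : ℕ)).mulVec vK)]
      simp [map_sum, mul_comm]
    rw [e3, e2, Pi.single_apply]
    split_ifs <;> simp

theorem MvPolynomial.IsHomogeneous.eval_smul {σ R : Type*} [CommSemiring R] {p : MvPolynomial σ R}
    {n : ℕ} (hp : p.IsHomogeneous n) (t : R) (x : σ → R) :
    MvPolynomial.eval (t • x) p = t ^ n * MvPolynomial.eval x p := by
  rw [MvPolynomial.eval_eq, MvPolynomial.eval_eq, Finset.mul_sum]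
  refine Finset.sum_congr rfl fun d hd => ?_
  have h := hp (MvPolynomial.mem_support_iff.1 hd)
  simp only [Pi.smul_apply, smul_eq_mul, mul_pow, Finset.prod_mul_distrib, Finset.prod_pow_eq_pow_sum]
  have h2 : ∑ i ∈ d.support, d i = n := by
    rw [← h, Finsupp.weight_apply]; simp [Finsupp.sum]
  rw [h2]; ring

theorem MvPolynomial.eval_smul_eq_sum {σ R : Type*} [CommSemiring R] (p : MvPolynomial σ R)
    (t : R) (x : σ → R) :
    MvPolynomial.eval (t • x) p = ∑ m ∈ Finset.range (p.totalDegree + 1),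
      t ^ m * MvPolynomial.eval x (MvPolynomial.homogeneousComponent m p) := by
  conv_lhs => rw [← MvPolynomial.sum_homogeneousComponent p]
  rw [map_sum]
  exact Finset.sum_congr rfl fun m _ =>
    (MvPolynomial.homogeneousComponent_isHomogeneous m p).eval_smul t x

/-! ### The generic element, the rank and the characteristic coefficients -/

namespace EuclideanJordanAlgebra

variable {W : Type*} [NormedAddCommGroup W] [InnerProductSpace ℝ W] (E : EuclideanJordanAlgebra W)

theorem one_ne_zero [Nontrivial W] : E.one ≠ 0 := by
  intro h
  obtain ⟨x, hx⟩ := exists_ne (0 : W)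
  apply hx
  rw [← E.mul_one x, h, map_zero]

theorem linearIndependent_pow_of_le {x : W} {k d : ℕ} (hkd : k ≤ d)
    (h : LinearIndependent ℝ (fun i : Fin d => E.pow x i)) :
    LinearIndependent ℝ (fun i : Fin k => E.pow x i) :=
  h.comp (Fin.castLE hkd) (Fin.castLE_injective hkd)

theorem pow_smul (t : ℝ) (x : W) (k : ℕ) : E.pow (t • x) k = t ^ k • E.pow x k := by
  induction k with
  | zero => simp [pow]
  | succ k ih =>
    rw [pow_succ_eq, ih, pow_succ_eq, map_smul, LinearMap.map_smul₂, smul_smul, pow_succ]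

section Generic

variable [FiniteDimensional ℝ W]

/-- The multiplication matrix of the generic element. -/
noncomputable def genericMatrix : Matrix (Fin (Module.finrank ℝ W)) (Fin (Module.finrank ℝ W))
    (MvPolynomial (Fin (Module.finrank ℝ W)) ℝ) :=
  fun i k => ∑ j, MvPolynomial.X j * MvPolynomial.C ((Module.finBasis ℝ W).repr
    (E.mul (Module.finBasis ℝ W j) (Module.finBasis ℝ W k)) i)

/-- Specializing the generic element to `x` turns the generic matrix into the matrix of `L_x`, so
relations over the polynomial ring specialize to relations between powers of `x`. -/
theorem evalAt_genericMatrix_pow (x : W) (m : ℕ) (i : Fin (Module.finrank ℝ W)) :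
    evalAt x (((E.genericMatrix ^ m).mulVec
      fun k => MvPolynomial.C ((Module.finBasis ℝ W).repr E.one k)) i) =
      (Module.finBasis ℝ W).repr (E.pow x m) i := by
  induction m generalizing i with
  | zero => simp [evalAt, pow]
  | succ m ih =>
    rw [pow_succ', ← Matrix.mulVec_mulVec]
    simp only [evalAt, Matrix.mulVec, dotProduct, map_sum, map_mul, genericMatrix,
      MvPolynomial.eval_X, MvPolynomial.eval_C] at ih ⊢
    simp only [ih]
    set b := Module.finBasis ℝ W
    have h : E.pow x (m + 1) = ∑ k, ∑ j, (b.repr (E.pow x m) k * b.repr x j) • E.mul (b j) (b k) := by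
      rw [pow_succ_eq]
      conv_lhs => rw [← b.sum_repr (E.pow x m)]
      conv_lhs => enter [1, 2]; rw [← b.sum_repr x]
      simp only [map_sum, LinearMap.sum_apply, map_smul, LinearMap.smul_apply, Finset.smul_sum,
        smul_smul]
    rw [h]
    simp only [map_sum, map_smul, Finsupp.coe_finsetSum, Finset.sum_apply, Finsupp.coe_smul,
      Pi.smul_apply, smul_eq_mul, Finset.sum_mul]
    exact Finset.sum_congr rfl fun k _ => Finset.sum_congr rfl fun j _ => by ring

/-- The rank is attained on the complement of the zero set of a polynomial, and there is a
generic characteristic polynomial of this degree. -/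
theorem exists_generic [Nontrivial W] :
    ∃ s : MvPolynomial (Fin (Module.finrank ℝ W)) ℝ, s ≠ 0 ∧
      (∀ x : W, evalAt x s ≠ 0 → LinearIndependent ℝ (fun i : Fin E.rank => E.pow x i)) ∧
      ∃ p : ℕ → MvPolynomial (Fin (Module.finrank ℝ W)) ℝ, p E.rank = 1 ∧
        ∀ x : W, ∑ k ∈ Finset.range (E.rank + 1), evalAt x (p k) • E.pow x k = 0 := by
  obtain ⟨q, hq, hrel, N, s, hs, hN⟩ := Matrix.exists_minpoly_vector E.genericMatrix
    (fun k => MvPolynomial.C ((Module.finBasis ℝ W).repr E.one k))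
  set b := Module.finBasis ℝ W with hb
  have hrel' : ∀ x : W, ∑ k ∈ Finset.range (q.natDegree + 1), evalAt x (q.coeff k) • E.pow x k = 0 := by
    intro x
    apply b.repr.injective
    ext i
    have := congrArg (MvPolynomial.eval (fun j => b.repr x j)) (congrFun hrel i)
    simp only [Finset.sum_apply, Pi.smul_apply, smul_eq_mul, Pi.zero_apply, map_zero] at this
    rw [map_zero, Finsupp.coe_zero, Pi.zero_apply]
    simp only [map_sum, map_smul, Finsupp.coe_finsetSum, Finset.sum_apply, Finsupp.coe_smul,
      Pi.smul_apply, smul_eq_mul]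
    rw [← this]
    simp only [evalAt, map_sum, map_mul]
    refine Finset.sum_congr rfl fun k _ => ?_
    rw [← E.evalAt_genericMatrix_pow x k i]
    rfl
  -- After specialization, `N` is still a left inverse up to the factor `s(x)`, which is a unit
  -- here.
  have hind : ∀ x : W, evalAt x s ≠ 0 →
      LinearIndependent ℝ (fun i : Fin q.natDegree => E.pow x i) := by
    intro x hx
    rw [Fintype.linearIndependent_iff]
    intro g hg k
    have h1 : ∀ l : Fin q.natDegree, ∑ i, evalAt x (N k i) * b.repr (E.pow x l) i =
        if k = l then evalAt x s else 0 := by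
      intro l
      have := congrArg (MvPolynomial.eval (fun j => b.repr x j)) (hN k l)
      rw [apply_ite (MvPolynomial.eval (fun j => b.repr x j)), map_zero] at this
      rw [evalAt, ← this]
      simp only [evalAt, map_sum, map_mul]
      refine Finset.sum_congr rfl fun i _ => ?_
      rw [← E.evalAt_genericMatrix_pow x l i]
      rfl
    have h2 : ∑ l, g l * (∑ i, evalAt x (N k i) * b.repr (E.pow x l) i) = 0 := by
      have h3 : ∀ i, ∑ l, g l * b.repr (E.pow x l) i = 0 := by
        intro i
        have := congrArg (fun w => b.repr w i) hg
        simpa using this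
      simp_rw [Finset.mul_sum]
      rw [Finset.sum_comm]
      refine Finset.sum_eq_zero fun i _ => ?_
      have : ∀ l, g l * (evalAt x (N k i) * b.repr (E.pow x l) i) =
        evalAt x (N k i) * (g l * b.repr (E.pow x l) i) := fun l => by ring
      rw [Finset.sum_congr rfl fun l _ => this l, ← Finset.mul_sum, h3, mul_zero]
    simp only [h1, mul_ite, mul_zero, Finset.sum_ite_eq, Finset.mem_univ, if_true] at h2
    exact (mul_eq_zero.1 h2).resolve_right hx
  have hd0 : 0 < q.natDegree := by
    rcases Nat.eq_zero_or_pos q.natDegree with h | h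
    · exfalso
      have := hrel' 0
      rw [h] at this
      rw [zero_add, Finset.sum_range_one] at this
      rw [show q.coeff 0 = 1 by rw [← h]; exact hq.coeff_natDegree] at this
      rw [show evalAt (0 : W) (1 : MvPolynomial (Fin (Module.finrank ℝ W)) ℝ) = 1 from map_one _,
        one_smul] at this
      exact E.one_ne_zero this
    · exact h
  have hdep : ∀ x : W, ¬ LinearIndependent ℝ (fun i : Fin (q.natDegree + 1) => E.pow x i) := by
    intro x h
    rw [Fintype.linearIndependent_iff] at h
    have h1 := hrel' x
    rw [← Fin.sum_univ_eq_sum_range (fun k => evalAt x (q.coeff k) • E.pow x k)] at h1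
    have h2 := h (fun i => evalAt x (q.coeff i)) h1 (Fin.last _)
    rw [Fin.val_last, hq.coeff_natDegree] at h2
    rw [show evalAt x (1 : MvPolynomial (Fin (Module.finrank ℝ W)) ℝ) = 1 from map_one _] at h2
    exact _root_.one_ne_zero h2
  have hle : ∀ x, E.deg x ≤ q.natDegree := fun x => Nat.sInf_le ⟨hd0, hdep x⟩
  have hex : ∃ x : W, evalAt x s ≠ 0 := by
    by_contra! h
    apply hs
    refine MvPolynomial.funext fun y => ?_
    have := h (b.equivFun.symm y)
    rw [map_zero, ← this, evalAt]
    congr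
    funext j
    exact (congrFun (b.equivFun.apply_symm_apply y) j).symm
  have hrank : E.rank = q.natDegree := by
    apply le_antisymm
    · exact csSup_le (Set.range_nonempty _) (by rintro _ ⟨x, rfl⟩; exact hle x)
    · obtain ⟨x, hx⟩ := hex
      refine le_trans ?_ (le_csSup ⟨q.natDegree, by rintro _ ⟨x, rfl⟩; exact hle x⟩ ⟨x, rfl⟩)
      refine le_csInf ⟨_, hd0, hdep x⟩ ?_
      rintro k ⟨_, hk⟩
      by_contra! hlt
      exact hk (E.linearIndependent_pow_of_le hlt (hind x hx))
  rw [hrank]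
  exact ⟨s, hs, hind, q.coeff, hq.coeff_natDegree, hrel'⟩

theorem evalAt_smul_of_isHomogeneous {p : MvPolynomial (Fin (Module.finrank ℝ W)) ℝ} {n : ℕ}
    (hp : p.IsHomogeneous n) (t : ℝ) (x : W) : evalAt (t • x) p = t ^ n * evalAt x p := by
  have := hp.eval_smul t (fun j => (Module.finBasis ℝ W).repr x j)
  rw [evalAt, evalAt, ← this]
  simp [Pi.smul_def]

theorem evalAt_smul_eq_sum (p : MvPolynomial (Fin (Module.finrank ℝ W)) ℝ)
    (t : ℝ) (x : W) : evalAt (t • x) p = ∑ m ∈ Finset.range (p.totalDegree + 1),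
      t ^ m * evalAt x (MvPolynomial.homogeneousComponent m p) := by
  have := MvPolynomial.eval_smul_eq_sum p t (fun j => (Module.finBasis ℝ W).repr x j)
  simp only [evalAt]
  rw [← this]
  simp [Pi.smul_def]

/-- The generic coefficients are not known to be homogeneous. The relation at `t • x` is polynomial
in `t`, and its coefficient at `t ^ r` retains exactly the degree `i` part of the coefficient of `x
^ (r - i)`. -/
theorem exists_isCharCoeffs [Nontrivial W] : ∃ a, E.IsCharCoeffs a := by
  obtain ⟨s, -, -, p, hp1, hp⟩ := E.exists_generic
  set r := E.rank with hr
  let a : ℕ → MvPolynomial (Fin (Module.finrank ℝ W)) ℝ := fun i =>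
    if i ≤ r then MvPolynomial.C ((-1 : ℝ) ^ i) * MvPolynomial.homogeneousComponent i (p (r - i)) else 0
  refine ⟨a, ?_, ?_, ?_, ?_⟩
  · simp [a, hp1]
  · intro i
    simp only [a]
    split_ifs
    · have := (MvPolynomial.isHomogeneous_C (Fin (Module.finrank ℝ W)) ((-1 : ℝ) ^ i)).mul
        (MvPolynomial.homogeneousComponent_isHomogeneous i (p (r - i)))
      rwa [zero_add] at this
    · exact MvPolynomial.isHomogeneous_zero _ _ _
  · intro i hi
    simp only [a]
    rw [if_neg (by omega)]
  · intro x
    have ha : ∀ i ∈ Finset.range (r + 1), ((-1 : ℝ) ^ i * evalAt x (a i)) • E.pow x (r - i) =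
        evalAt x (MvPolynomial.homogeneousComponent i (p (r - i))) • E.pow x (r - i) := by
      intro i hi
      have hi' : i ≤ r := by have := Finset.mem_range.1 hi; omega
      simp only [a, if_pos hi', evalAt, map_mul, MvPolynomial.eval_C]
      rw [← mul_assoc, ← mul_pow]
      simp
    rw [Finset.sum_congr rfl ha]
    apply (Module.finBasis ℝ W).repr.injective
    ext j
    set b := Module.finBasis ℝ W
    let Q : Polynomial ℝ := ∑ k ∈ Finset.range (r + 1),
      ∑ m ∈ Finset.range ((p k).totalDegree + 1), Polynomial.monomial (m + k)
        (evalAt x (MvPolynomial.homogeneousComponent m (p k)) * b.repr (E.pow x k) j)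
    have hQ : Q = 0 := by
      refine Polynomial.funext fun t => ?_
      have h := congrArg (fun w => b.repr w j) (hp (t • x))
      simp only [map_sum, map_smul, Finsupp.coe_finsetSum, Finset.sum_apply, Finsupp.coe_smul,
        Pi.smul_apply, smul_eq_mul, map_zero, Finsupp.coe_zero, Pi.zero_apply] at h
      rw [Polynomial.eval_zero, ← h]
      simp only [Q, Polynomial.eval_finsetSum, Polynomial.eval_monomial]
      refine Finset.sum_congr rfl fun k _ => ?_
      rw [evalAt_smul_eq_sum, pow_smul, Finset.sum_mul]
      refine Finset.sum_congr rfl fun m _ => ?_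
      simp only [map_smul, Finsupp.coe_smul, Pi.smul_apply, smul_eq_mul]
      ring
    have hc := congrArg (fun Q => Polynomial.coeff Q r) hQ
    simp only [Q, Polynomial.finsetSum_coeff, Polynomial.coeff_monomial, Polynomial.coeff_zero] at hc
    simp only [map_sum, map_smul, Finsupp.coe_finsetSum, Finset.sum_apply, Finsupp.coe_smul,
        Pi.smul_apply, smul_eq_mul, map_zero, Finsupp.coe_zero, Pi.zero_apply]
    rw [← hc, ← Finset.sum_range_reflect]
    refine Finset.sum_congr rfl fun k hk => ?_
    have hk' : k ≤ r := by have := Finset.mem_range.1 hk; omega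
    rw [show r + 1 - 1 - k = r - k by omega, show r - (r - k) = k by omega]
    by_cases hm : r - k ∈ Finset.range ((p k).totalDegree + 1)
    · rw [Finset.sum_eq_single_of_mem _ hm]
      · rw [if_pos (by omega)]
      · intro m _ hne
        rw [if_neg (by omega)]
    · rw [Finset.sum_eq_zero, MvPolynomial.homogeneousComponent_eq_zero (r - k) (p k)]
      · simp [evalAt]
      · rw [Finset.mem_range] at hm
        omega
      · intro m hm'
        rw [if_neg]
        intro h
        apply hm
        rwa [show r - k = m by omega]

theorem isCharCoeffs_charCoeffs [Nontrivial W] : E.IsCharCoeffs E.charCoeffs := by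
  have h := E.exists_isCharCoeffs
  rw [charCoeffs, dif_pos h]
  exact h.choose_spec

theorem analyticAt_evalAt (p : MvPolynomial (Fin (Module.finrank ℝ W)) ℝ) (x : W) :
    AnalyticAt ℝ (fun y => evalAt y p) x :=
  AnalyticOnNhd.eval_linearMap' (fun j => (Module.finBasis ℝ W).coord j) p x (Set.mem_univ x)

theorem continuous_evalAt (p : MvPolynomial (Fin (Module.finrank ℝ W)) ℝ) :
    Continuous (fun y : W => evalAt y p) :=
  continuous_iff_continuousAt.2 fun x => (analyticAt_evalAt p x).continuousAt

/-- The complement of the zero set of a nonzero polynomial is dense. -/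
theorem dense_evalAt_ne_zero {s : MvPolynomial (Fin (Module.finrank ℝ W)) ℝ} (hs : s ≠ 0) :
    Dense {x : W | evalAt x s ≠ 0} := by
  have h : AnalyticOnNhd ℝ (fun y : W => evalAt y s) Set.univ := fun x _ => analyticAt_evalAt s x
  intro x
  by_contra hx
  apply hs
  have hev : (fun y : W => evalAt y s) =ᶠ[nhds x] 0 := by
    rw [mem_closure_iff_nhds] at hx
    push Not at hx
    obtain ⟨t, ht, hx⟩ := hx
    filter_upwards [ht] with y hy
    by_contra hne
    exact (Set.eq_empty_iff_forall_notMem.1 hx y) ⟨hy, hne⟩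
  have h0 := h.eqOn_zero_of_preconnected_of_eventuallyEq_zero isPreconnected_univ (Set.mem_univ x) hev
  refine MvPolynomial.funext fun y => ?_
  have := h0 (Set.mem_univ ((Module.finBasis ℝ W).equivFun.symm y))
  simp only [Pi.zero_apply] at this
  rw [map_zero, ← this, evalAt]
  congr
  funext j
  exact (congrFun ((Module.finBasis ℝ W).equivFun.apply_symm_apply y) j).symm

end Generic

end EuclideanJordanAlgebra

/-! ### Frames and their existence -/

namespace EuclideanJordanAlgebra

variable {W : Type*} [NormedAddCommGroup W] [InnerProductSpace ℝ W] (E : EuclideanJordanAlgebra W)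

section Continuity

variable [FiniteDimensional ℝ W]

/-- The Jordan product as a continuous bilinear map. -/
noncomputable def mulL : W →L[ℝ] W →L[ℝ] W :=
  LinearMap.toContinuousLinearMap
    ((LinearMap.toContinuousLinearMap : (W →ₗ[ℝ] W) ≃ₗ[ℝ] (W →L[ℝ] W)).toLinearMap.comp E.mul)

theorem mulL_apply (x y : W) : E.mulL x y = E.mul x y := rfl

theorem continuous_mul {X : Type*} [TopologicalSpace X] {f g : X → W} (hf : Continuous f)
    (hg : Continuous g) : Continuous fun z => E.mul (f z) (g z) :=
  (E.mulL.continuous.comp hf).clm_apply hg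

/-- Boundedness of the product gives `‖c‖ = ‖c ∘ c‖ ≤ C ‖c‖²`. The uniform gap keeps limits of
nonzero idempotents nonzero. -/
theorem exists_norm_idem_ge : ∃ δ > 0, ∀ c, E.mul c c = c → c ≠ 0 → δ ≤ ‖c‖ := by
  refine ⟨1 / (‖E.mulL‖ + 1), by positivity, fun c hc h0 => ?_⟩
  have h1 : ‖c‖ ≤ ‖E.mulL‖ * ‖c‖ * ‖c‖ := by
    conv_lhs => rw [← hc]
    exact E.mulL.le_opNorm₂ c c
  have h2 : 0 < ‖c‖ := norm_pos_iff.2 h0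
  rw [div_le_iff₀ (by positivity)]
  nlinarith

end Continuity

theorem norm_idem_le {c : W} (hc : E.mul c c = c) : ‖c‖ ≤ ‖E.one‖ := by
  have h : ‖c‖ ^ 2 ≤ ‖c‖ * ‖E.one‖ := by
    have h1 : inner ℝ c c = inner ℝ c E.one := by
      conv_rhs => rw [← hc, E.inner_mul_left, E.mul_one]
    rw [← real_inner_self_eq_norm_sq, h1]
    exact real_inner_le_norm _ _
  by_contra! h2
  nlinarith [norm_nonneg c, norm_nonneg E.one]

/-- A complete system of `r` orthogonal nonzero idempotents, where `r` is the rank. -/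
structure IsFrame (c : Fin E.rank → W) : Prop where
  mul_eq : ∀ i j, E.mul (c i) (c j) = if i = j then c i else 0
  sum_eq : ∑ i, c i = E.one
  ne_zero : ∀ i, c i ≠ 0

/-- The coordinate of `w` along the idempotent `c`. -/
noncomputable def coord (c w : W) : ℝ := inner ℝ w c / ‖c‖ ^ 2

variable {E}

namespace IsFrame

variable {c : Fin E.rank → W} (h : E.IsFrame c)
include h

theorem idem (i : Fin E.rank) : E.mul (c i) (c i) = c i := by rw [h.mul_eq, if_pos rfl]

theorem combo_mul (μ : Fin E.rank → ℝ) (j : Fin E.rank) :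
    E.mul (∑ i, μ i • c i) (c j) = μ j • c j := by
  simp only [map_sum, LinearMap.sum_apply, map_smul, LinearMap.smul_apply, h.mul_eq, smul_ite,
    smul_zero, Finset.sum_ite_eq', Finset.mem_univ, if_true]

theorem combo_mul_combo (μ ν : Fin E.rank → ℝ) :
    E.mul (∑ i, μ i • c i) (∑ i, ν i • c i) = ∑ i, (μ i * ν i) • c i := by
  rw [map_sum]
  refine Finset.sum_congr rfl fun j _ => ?_
  rw [map_smul, h.combo_mul, smul_smul, _root_.mul_comm]

theorem norm_sq_pos (i : Fin E.rank) : 0 < ‖c i‖ ^ 2 := by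
  have := norm_pos_iff.2 (h.ne_zero i); positivity

theorem inner_eq (i j : Fin E.rank) : inner ℝ (c i) (c j) = if i = j then ‖c i‖ ^ 2 else 0 := by
  split_ifs with hij
  · rw [hij, real_inner_self_eq_norm_sq]
  · rw [← h.idem i, E.inner_mul_left, h.mul_eq, if_neg hij, inner_zero_right]

theorem inner_combo (μ : Fin E.rank → ℝ) (j : Fin E.rank) :
    inner ℝ (∑ i, μ i • c i) (c j) = μ j * ‖c j‖ ^ 2 := by
  simp [sum_inner, inner_smul_left, h.inner_eq]

theorem coord_combo (μ : Fin E.rank → ℝ) (j : Fin E.rank) :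
    coord (c j) (∑ i, μ i • c i) = μ j := by
  rw [coord, h.inner_combo, mul_div_cancel_right₀ _ (h.norm_sq_pos j).ne']

theorem inner_eq_coord (w : W) (j : Fin E.rank) : inner ℝ w (c j) = coord (c j) w * ‖c j‖ ^ 2 := by
  rw [coord, div_mul_cancel₀ _ (h.norm_sq_pos j).ne']

/-- Here `w` need not lie in the span of the frame: associativity of the inner product moves the
multiplication onto its eigenvector `c j`. -/
theorem coord_combo_mul (μ : Fin E.rank → ℝ) (w : W) (j : Fin E.rank) :
    coord (c j) (E.mul (∑ i, μ i • c i) w) = μ j * coord (c j) w := by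
  rw [coord, E.inner_mul_left, h.combo_mul, inner_smul_right, coord, mul_div_assoc]

theorem pow_combo (μ : Fin E.rank → ℝ) (k : ℕ) :
    E.pow (∑ i, μ i • c i) k = ∑ i, μ i ^ k • c i := by
  induction k with
  | zero => simp [pow, h.sum_eq]
  | succ k ih =>
    rw [pow_succ_eq, ih, h.combo_mul_combo]
    simp [pow_succ, _root_.mul_comm]

theorem one_eq_combo : E.one = ∑ i, (1 : ℝ) • c i := by simp [h.sum_eq]

end IsFrame

variable (E)

section CharPoly

variable [FiniteDimensional ℝ W]

/-- The characteristic polynomial at `x`. -/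
noncomputable def charPoly (x : W) : Polynomial ℝ :=
  ∑ i ∈ Finset.range (E.rank + 1),
    Polynomial.monomial (E.rank - i) ((-1) ^ i * evalAt x (E.charCoeffs i))

/-- The derivative of the characteristic polynomial at `x` along `w`. -/
noncomputable def charPolyDeriv (x w : W) : Polynomial ℝ :=
  ∑ i ∈ Finset.range (E.rank + 1),
    Polynomial.monomial (E.rank - i)
      ((-1) ^ i * fderiv ℝ (fun y => evalAt y (E.charCoeffs i)) x w)

theorem coeff_sum_monomial_sub (r : ℕ) (f : ℕ → ℝ) {i : ℕ} (hi : i ≤ r) :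
    (∑ i ∈ Finset.range (r + 1), Polynomial.monomial (r - i) (f i)).coeff (r - i) = f i := by
  simp only [Polynomial.finsetSum_coeff, Polynomial.coeff_monomial]
  rw [Finset.sum_eq_single_of_mem i (by simp; omega)]
  · simp
  · intro j hj hji
    rw [Finset.mem_range] at hj
    rw [if_neg (by omega)]

theorem degree_sum_monomial_sub_lt (r : ℕ) (f : ℕ → ℝ) (h0 : f 0 = 0) :
    (∑ i ∈ Finset.range (r + 1), Polynomial.monomial (r - i) (f i)).degree < r := by
  rw [Finset.sum_range_succ', h0, map_zero, add_zero]
  refine lt_of_le_of_lt (Polynomial.degree_sum_le _ _) ?_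
  rw [Finset.sup_lt_iff (WithBot.bot_lt_coe _)]
  intro i hi
  refine lt_of_le_of_lt (Polynomial.degree_monomial_le _ _) ?_
  rw [Finset.mem_range] at hi
  exact_mod_cast (by omega : r - (i + 1) < r)

variable [Nontrivial W]

theorem charCoeffs_zero (x : W) : evalAt x (E.charCoeffs 0) = 1 := by
  rw [E.isCharCoeffs_charCoeffs.1]; exact map_one _

/-- Monicity in degree `r`, in the form needed to identify the characteristic polynomial from its
values at `r` points. -/
theorem degree_charPoly_sub_lt (x : W) {q : Polynomial ℝ} (hq : q.Monic)
    (hd : q.natDegree = E.rank) : (E.charPoly x - q).degree < E.rank := by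
  have h1 : E.charPoly x = (∑ i ∈ Finset.range (E.rank + 1), Polynomial.monomial (E.rank - i)
      (if i = 0 then 0 else (-1) ^ i * evalAt x (E.charCoeffs i))) + Polynomial.X ^ E.rank := by
    rw [charPoly, Finset.sum_range_succ', Finset.sum_range_succ']
    simp [charCoeffs_zero, Polynomial.X_pow_eq_monomial]
  rw [h1, add_sub_assoc]
  refine lt_of_le_of_lt (Polynomial.degree_add_le _ _) (max_lt ?_ ?_)
  · exact degree_sum_monomial_sub_lt _ _ (if_pos rfl)
  · have := Polynomial.degree_sub_lt_left (p := Polynomial.X ^ E.rank) (q := q)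
      (by rw [Polynomial.degree_X_pow, Polynomial.degree_eq_natDegree hq.ne_zero, hd])
      (Polynomial.monic_X_pow _).ne_zero (by rw [Polynomial.leadingCoeff_X_pow, hq.leadingCoeff])
    rwa [Polynomial.degree_X_pow] at this

/-- Pair the characteristic identity with `c`, using `⟨x ^ k, c⟩ = l ^ k ‖c‖²`. -/
theorem eval_charPoly_eq_zero {x c : W} {l : ℝ} (hc : c ≠ 0) (hi : E.mul c c = c)
    (hx : E.mul x c = l • c) : (E.charPoly x).eval l = 0 := by
  have h1 : ∀ k, inner ℝ (E.pow x k) c = l ^ k * ‖c‖ ^ 2 := by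
    intro k
    induction k with
    | zero =>
      rw [← real_inner_self_eq_norm_sq, pow]
      conv_lhs => rw [← hi, E.inner_mul_right, E.mul_one]
      simp
    | succ k ih =>
      rw [pow_succ_eq, E.inner_mul_left, hx, inner_smul_right, ih]; ring
  have h := congrArg (fun w => inner ℝ w c) (E.isCharCoeffs_charCoeffs.2.2.2 x)
  simp only [sum_inner, inner_smul_left, h1, inner_zero_left, RCLike.conj_to_real, ← mul_assoc,
    ← Finset.sum_mul] at h
  have hn : ‖c‖ ^ 2 ≠ 0 := by simpa using hc
  rw [charPoly, Polynomial.eval_finsetSum]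
  simpa [hn] using h

/-- There are at most `r` spectral idempotents, since their eigenvalues are distinct roots of a
polynomial of degree `r`. There are at least `r`, since they span the `r` independent powers of a
regular `x`. -/
theorem exists_isFrame_of_regular : ∃ s : MvPolynomial (Fin (Module.finrank ℝ W)) ℝ, s ≠ 0 ∧
    ∀ x : W, evalAt x s ≠ 0 → ∃ c, E.IsFrame c ∧ ∃ μ : Fin E.rank → ℝ, x = ∑ i, μ i • c i := by
  classical
  obtain ⟨s, hs, hind, -⟩ := E.exists_generic
  refine ⟨s, hs, fun x hx => ?_⟩
  obtain ⟨S, c, hne, hsum, heig, hmul⟩ := E.exists_spectral x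
  have hidem : ∀ l ∈ S, E.mul (c l) (c l) = c l := fun l hl => by rw [hmul l hl l hl, if_pos rfl]
  have hmon : (Polynomial.X ^ E.rank : Polynomial ℝ).Monic := Polynomial.monic_X_pow _
  have hcard1 : S.card ≤ E.rank := by
    have hd := E.degree_charPoly_sub_lt x hmon (by simp)
    have hp0 : E.charPoly x ≠ 0 := by
      intro h0
      rw [h0, zero_sub, Polynomial.degree_neg, Polynomial.degree_X_pow] at hd
      exact lt_irrefl _ hd
    have hnd : (E.charPoly x).degree ≤ E.rank := by
      have := Polynomial.degree_add_le (E.charPoly x - Polynomial.X ^ E.rank) (Polynomial.X ^ E.rank)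
      rw [sub_add_cancel, Polynomial.degree_X_pow] at this
      exact this.trans (max_le hd.le le_rfl)
    have h1 : S ⊆ (E.charPoly x).roots.toFinset := by
      intro l hl
      rw [Multiset.mem_toFinset, Polynomial.mem_roots hp0]
      exact E.eval_charPoly_eq_zero (hne l hl) (hidem l hl) (heig l hl)
    refine (Finset.card_le_card h1).trans ((Multiset.toFinset_card_le _).trans ?_)
    have := (Polynomial.card_roots hp0).trans hnd
    exact_mod_cast this
  have hpow : ∀ k, E.pow x k = ∑ l ∈ S, l ^ k • c l := by
    intro k
    induction k with
    | zero => simp [pow, hsum]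
    | succ k ih =>
      rw [pow_succ_eq, ih, map_sum]
      exact Finset.sum_congr rfl fun l hl => by rw [map_smul, heig l hl, smul_smul, pow_succ]
  have hcard2 : E.rank ≤ S.card := by
    have h1 := finrank_span_eq_card (hind x hx)
    rw [Fintype.card_fin] at h1
    rw [← h1]
    refine le_trans (Submodule.finrank_mono ?_) ((finrank_span_finset_le_card (R := ℝ)
      (S.image c)).trans Finset.card_image_le)
    rw [Submodule.span_le]
    rintro _ ⟨k, rfl⟩
    simp only [hpow]
    exact Submodule.sum_mem _ fun l hl => Submodule.smul_mem _ _
      (Submodule.subset_span (Finset.mem_coe.2 (Finset.mem_image_of_mem _ hl)))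
  let e := S.equivFinOfCardEq (le_antisymm hcard1 hcard2)
  refine ⟨fun i => c (e.symm i), ⟨fun i j => ?_, ?_, fun i => hne _ (e.symm i).2⟩,
    fun i => (e.symm i : ℝ), ?_⟩
  · rw [hmul _ (e.symm i).2 _ (e.symm j).2]
    simp
  · rw [← hsum, ← Finset.sum_coe_sort S]
    exact Equiv.sum_comp e.symm (fun l : S => c l)
  · have := hpow 1
    rw [pow_one_eq] at this
    rw [this, ← Finset.sum_coe_sort S]
    simp only [pow_one]
    exact (Equiv.sum_comp e.symm (fun l : S => (l : ℝ) • c l)).symm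

/-- Every element is a combination of a frame. -/
theorem exists_isFrame (x : W) :
    ∃ c, E.IsFrame c ∧ ∃ μ : Fin E.rank → ℝ, x = ∑ i, μ i • c i := by
  obtain ⟨s, hs, hreg⟩ := E.exists_isFrame_of_regular
  obtain ⟨δ, hδ, hδc⟩ := E.exists_norm_idem_ge
  -- Approximate `x` by regular elements. Their frames are bounded by `‖e‖`, so a subsequence
  -- converges, and the coefficients converge because `coord` recovers them continuously.
  have hx := dense_evalAt_ne_zero hs x
  rw [mem_closure_iff_seq_limit] at hx
  obtain ⟨y, hy, hyx⟩ := hx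
  choose c hc μ hμ using fun n => hreg (y n) (hy n)
  have hbd : ∀ n, c n ∈ Metric.closedBall (0 : Fin E.rank → W) ‖E.one‖ := by
    intro n
    rw [mem_closedBall_zero_iff, pi_norm_le_iff_of_nonneg (norm_nonneg _)]
    exact fun i => E.norm_idem_le ((hc n).idem i)
  obtain ⟨d, -, φ, hφ, hlim⟩ := (isCompact_closedBall _ _).tendsto_subseq hbd
  have hlim' : ∀ i, Filter.Tendsto (fun n => c (φ n) i) Filter.atTop (nhds (d i)) :=
    fun i => (tendsto_pi_nhds.1 hlim) i
  have hne : ∀ i, d i ≠ 0 := by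
    intro i
    have : δ ≤ ‖d i‖ := ge_of_tendsto (hlim' i).norm
      (Filter.Eventually.of_forall fun n => hδc _ ((hc _).idem i) ((hc _).ne_zero i))
    exact norm_pos_iff.1 (hδ.trans_le this)
  refine ⟨d, ⟨fun i j => ?_, ?_, hne⟩, fun i => coord (d i) x, ?_⟩
  · have h1 : Filter.Tendsto (fun n => E.mul (c (φ n) i) (c (φ n) j)) Filter.atTop
        (nhds (E.mul (d i) (d j))) :=
      ((E.continuous_mul continuous_fst continuous_snd).tendsto (d i, d j)).comp
        ((hlim' i).prodMk_nhds (hlim' j))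
    refine tendsto_nhds_unique h1 ?_
    simp only [fun n => (hc n).mul_eq i j]
    split_ifs
    · exact hlim' i
    · exact tendsto_const_nhds
  · refine tendsto_nhds_unique (tendsto_finsetSum _ fun i _ => hlim' i) ?_
    simp only [fun n => (hc n).sum_eq]
    exact tendsto_const_nhds
  · have hyx' := hyx.comp hφ.tendsto_atTop
    refine tendsto_nhds_unique hyx' ?_
    have h2 : ∀ n, (y ∘ φ) n = ∑ i, coord (c (φ n) i) (y (φ n)) • c (φ n) i := by
      intro n
      rw [Function.comp_apply]
      conv_lhs => rw [hμ (φ n)]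
      refine Finset.sum_congr rfl fun i _ => ?_
      conv_rhs => rw [hμ (φ n), (hc (φ n)).coord_combo]
    refine Filter.Tendsto.congr (fun n => (h2 n).symm) ?_
    refine tendsto_finsetSum _ fun i _ => Filter.Tendsto.smul ?_ (hlim' i)
    exact (hyx'.inner (hlim' i)).div ((hlim' i).norm.pow 2)
      (by have := norm_pos_iff.2 (hne i); positivity)

theorem rank_pos : 0 < E.rank := by
  obtain ⟨c, hc, -⟩ := E.exists_isFrame 0
  by_contra! h
  have : IsEmpty (Fin E.rank) := by rw [Nat.le_zero.1 h]; infer_instance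
  exact E.one_ne_zero (by rw [← hc.sum_eq]; simp)

end CharPoly

end EuclideanJordanAlgebra

/-! ### Trace, determinant and the derivative of the determinant in a frame -/

namespace EuclideanJordanAlgebra

variable {W : Type*} [NormedAddCommGroup W] [InnerProductSpace ℝ W] (E : EuclideanJordanAlgebra W)

theorem hasDerivAt_line (x w : W) : HasDerivAt (fun t : ℝ => x + t • w) w 0 := by
  simpa using ((hasDerivAt_id (0 : ℝ)).smul_const w).const_add x

section Derivatives

variable [FiniteDimensional ℝ W]

theorem differentiable_evalAt (p : MvPolynomial (Fin (Module.finrank ℝ W)) ℝ) :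
    Differentiable ℝ (fun y : W => evalAt y p) :=
  fun x => (analyticAt_evalAt p x).differentiableAt

theorem continuous_fderiv_evalAt (p : MvPolynomial (Fin (Module.finrank ℝ W)) ℝ) (w : W) :
    Continuous (fun x : W => fderiv ℝ (fun y : W => evalAt y p) x w) := by
  have h : Continuous (fderiv ℝ (fun y : W => evalAt y p)) :=
    continuous_iff_continuousAt.2 fun x => (analyticAt_evalAt p x).fderiv.continuousAt
  exact h.clm_apply continuous_const

theorem hasDerivAt_evalAt_line (p : MvPolynomial (Fin (Module.finrank ℝ W)) ℝ) (x w : W) :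
    HasDerivAt (fun t : ℝ => evalAt (x + t • w) p) (fderiv ℝ (fun y => evalAt y p) x w) 0 :=
  (differentiable_evalAt p x).hasFDerivAt.hasLineDerivAt w

/-- A polynomial which is homogeneous of degree one is its own derivative. -/
theorem fderiv_evalAt_of_isHomogeneous_one {p : MvPolynomial (Fin (Module.finrank ℝ W)) ℝ}
    (hp : p.IsHomogeneous 1) (x w : W) : fderiv ℝ (fun y => evalAt y p) x w = evalAt w p := by
  have h0 : ∀ w : W, fderiv ℝ (fun y => evalAt y p) 0 w = evalAt w p := by
    intro w
    have h1 := hasDerivAt_evalAt_line p 0 w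
    have h2 : HasDerivAt (fun t : ℝ => evalAt ((0 : W) + t • w) p) (evalAt w p) 0 := by
      simp only [zero_add, evalAt_smul_of_isHomogeneous hp, pow_one]
      simpa using (hasDerivAt_id (0 : ℝ)).mul_const (evalAt w p)
    exact h1.unique h2
  have h3 : (fun y : W => evalAt y p) = fderiv ℝ (fun y : W => evalAt y p) 0 := by
    funext y; exact (h0 y).symm
  conv_lhs => rw [h3]
  rw [ContinuousLinearMap.fderiv, h0]

variable {E}

/-- The derivative itself has no simple form when `w` is outside the span of the frame. Paired with
`c j`, the multiplications by `x` and `x ^ k` become scalars and the usual power rule results. -/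
theorem IsFrame.exists_hasDerivAt_pow {c : Fin E.rank → W} (h : E.IsFrame c) (μ : Fin E.rank → ℝ)
    (w : W) (k : ℕ) : ∃ D, HasDerivAt (fun t : ℝ => E.pow ((∑ i, μ i • c i) + t • w) k) D 0 ∧
      ∀ j, inner ℝ D (c j) = k * μ j ^ (k - 1) * inner ℝ w (c j) := by
  set x := ∑ i, μ i • c i with hx
  induction k with
  | zero => exact ⟨0, hasDerivAt_const _ _, by simp⟩
  | succ k ih =>
    obtain ⟨D, hD, hDc⟩ := ih
    have h1 := (E.mulL.hasFDerivAt.comp_hasDerivAt 0 (hasDerivAt_line x w)).clm_apply hD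
    simp only [Function.comp_def, zero_smul, add_zero, mulL_apply] at h1
    refine ⟨_, h1, fun j => ?_⟩
    have hk : E.mul (E.pow x k) (c j) = μ j ^ k • c j := by rw [hx, h.pow_combo, h.combo_mul]
    have hx1 : E.mul x (c j) = μ j • c j := h.combo_mul μ j
    rw [inner_add_left, E.mul_comm w, E.inner_mul_left, hk, E.inner_mul_left, hx1, inner_smul_right,
      inner_smul_right, hDc]
    rcases k with _ | k
    · simp
    · simp only [Nat.add_sub_cancel]
      push_cast
      ring

variable [Nontrivial W]

namespace IsFrame

variable {c : Fin E.rank → W} (h : E.IsFrame c)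
include h

/-- Differentiate the characteristic identity along `w` and pair it with `c j`. The derivatives of
the coefficients give the left side, those of the powers the right side. -/
theorem eval_charPolyDeriv (μ : Fin E.rank → ℝ) (w : W) (j : Fin E.rank) :
    (E.charPolyDeriv (∑ i, μ i • c i) w).eval (μ j) =
      -((E.charPoly (∑ i, μ i • c i)).derivative.eval (μ j) * coord (c j) w) := by
  choose D hD hDc using h.exists_hasDerivAt_pow μ w
  have h1 : ∀ i, HasDerivAt (fun t : ℝ => ((-1 : ℝ) ^ i * evalAt ((∑ i, μ i • c i) + t • w)
      (E.charCoeffs i)) * inner ℝ (E.pow ((∑ i, μ i • c i) + t • w) (E.rank - i)) (c j)) _ 0 :=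
    fun i => ((hasDerivAt_evalAt_line (E.charCoeffs i) (∑ i, μ i • c i) w).const_mul
      ((-1 : ℝ) ^ i)).mul ((hD (E.rank - i)).inner ℝ (hasDerivAt_const (0 : ℝ) (c j)))
  have h2 := HasDerivAt.fun_sum (u := Finset.range (E.rank + 1)) fun i _ => h1 i
  have h3 : (fun t : ℝ => ∑ i ∈ Finset.range (E.rank + 1), ((-1 : ℝ) ^ i *
      evalAt ((∑ i, μ i • c i) + t • w) (E.charCoeffs i)) *
      inner ℝ (E.pow ((∑ i, μ i • c i) + t • w) (E.rank - i)) (c j)) = fun _ => 0 := by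
    funext t
    have := congrArg (fun w => inner ℝ w (c j))
      (E.isCharCoeffs_charCoeffs.2.2.2 ((∑ i, μ i • c i) + t • w))
    simpa only [sum_inner, inner_smul_left, inner_zero_left, RCLike.conj_to_real] using this
  rw [h3] at h2
  have h4 := h2.unique (hasDerivAt_const (0 : ℝ) (0 : ℝ))
  simp only [zero_smul, add_zero, h.pow_combo, h.inner_combo, hDc, inner_zero_right, zero_add] at h4
  have hn := h.norm_sq_pos j
  apply mul_right_cancel₀ hn.ne'
  rw [neg_mul, mul_assoc _ (coord _ _), ← h.inner_eq_coord, ← sub_eq_zero, sub_neg_eq_add, ← h4,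
    Finset.sum_add_distrib]
  simp only [charPolyDeriv, charPoly, Polynomial.eval_finsetSum, Polynomial.eval_monomial,
    Finset.sum_mul, Polynomial.derivative_sum, Polynomial.derivative_monomial]
  congr 1
  · exact Finset.sum_congr rfl fun i _ => by ring
  · exact Finset.sum_congr rfl fun i _ => by ring

theorem charPoly_eq_nodal {μ : Fin E.rank → ℝ} (hμ : Function.Injective μ) :
    E.charPoly (∑ i, μ i • c i) = Lagrange.nodal Finset.univ μ := by
  refine Polynomial.eq_of_degree_sub_lt_of_eval_index_eq Finset.univ hμ.injOn ?_ fun j _ => ?_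
  · rw [Finset.card_univ, Fintype.card_fin]
    exact E.degree_charPoly_sub_lt _ Lagrange.nodal_monic (by simp)
  · rw [Lagrange.eval_nodal_at_node (Finset.mem_univ j)]
    exact E.eval_charPoly_eq_zero (h.ne_zero j) (h.idem j) (h.combo_mul μ j)

/-- Both sides have degree below `r` and agree at the `r` distinct points `μ j`, where the
derivative of the nodal polynomial is the product over the other nodes. -/
theorem charPolyDeriv_eq {μ : Fin E.rank → ℝ} (hμ : Function.Injective μ) (w : W) :
    E.charPolyDeriv (∑ i, μ i • c i) w =
      -∑ j, Polynomial.C (coord (c j) w) * Lagrange.nodal (Finset.univ.erase j) μ := by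
  refine Polynomial.eq_of_degrees_lt_of_eval_index_eq Finset.univ hμ.injOn ?_ ?_ fun j _ => ?_
  · rw [Finset.card_univ, Fintype.card_fin]
    refine degree_sum_monomial_sub_lt _ _ ?_
    simp [charCoeffs_zero]
  · rw [Polynomial.degree_neg]
    refine lt_of_le_of_lt (Polynomial.degree_sum_le _ _) ?_
    rw [Finset.sup_lt_iff (WithBot.bot_lt_coe _)]
    intro i _
    rw [← Polynomial.smul_eq_C_mul]
    refine lt_of_le_of_lt (Polynomial.degree_smul_le _ _) ?_
    rw [Lagrange.degree_nodal]
    exact_mod_cast Finset.card_erase_lt_of_mem (Finset.mem_univ i)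
  · rw [h.eval_charPolyDeriv, h.charPoly_eq_nodal hμ,
      Lagrange.eval_nodal_derivative_eval_node_eq (Finset.mem_univ j), Polynomial.eval_neg,
      Polynomial.eval_finsetSum, Finset.sum_eq_single j]
    · rw [Polynomial.eval_mul, Polynomial.eval_C, _root_.mul_comm]
    · intro i _ hij
      rw [Polynomial.eval_mul, Lagrange.eval_nodal_at_node (Finset.mem_erase.2 ⟨hij.symm,
        Finset.mem_univ _⟩), mul_zero]
    · simp

/-- The trace in terms of a frame. -/
theorem tr_eq (w : W) : E.tr w = ∑ j, coord (c j) w := by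
  -- The derivative of the linear form `a₁` does not depend on the base point, so any distinct
  -- eigenvalues serve; take `0, …, r - 1` and compare coefficients in degree `r - 1`.
  have hμ : Function.Injective (fun i : Fin E.rank => ((i : ℕ) : ℝ)) :=
    fun i j hij => Fin.ext (Nat.cast_injective hij)
  have h1 := congrArg (fun p => Polynomial.coeff p (E.rank - 1)) (h.charPolyDeriv_eq hμ w)
  simp only [charPolyDeriv] at h1
  rw [coeff_sum_monomial_sub _ _ E.rank_pos,
    fderiv_evalAt_of_isHomogeneous_one (E.isCharCoeffs_charCoeffs.2.1 1), Polynomial.coeff_neg,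
    Polynomial.finsetSum_coeff] at h1
  have h2 : ∀ j, (Polynomial.C (coord (c j) w) * Lagrange.nodal (Finset.univ.erase j)
      (fun i : Fin E.rank => ((i : ℕ) : ℝ))).coeff (E.rank - 1) = coord (c j) w := by
    intro j
    rw [Polynomial.coeff_C_mul]
    have h3 := Lagrange.nodal_monic (s := Finset.univ.erase j)
      (v := (fun i : Fin E.rank => ((i : ℕ) : ℝ)))
    rw [Polynomial.Monic, Polynomial.leadingCoeff, Lagrange.natDegree_nodal,
      Finset.card_erase_of_mem (Finset.mem_univ j), Finset.card_univ, Fintype.card_fin] at h3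
    rw [h3, _root_.mul_one]
  rw [Finset.sum_congr rfl fun j _ => h2 j] at h1
  rw [tr]
  linarith

end IsFrame

/-- A continuous function of a tuple that vanishes at tuples with distinct entries vanishes. -/
theorem _root_.Continuous.eq_zero_of_injective {n : ℕ} {f : (Fin n → ℝ) → ℝ} (hf : Continuous f)
    (h0 : ∀ μ, Function.Injective μ → f μ = 0) (μ : Fin n → ℝ) : f μ = 0 := by
  -- The perturbation `μ i + t * i` has distinct entries except for finitely many `t`.
  let B : Set ℝ := ⋃ i : Fin n, ⋃ j : Fin n, {t | i ≠ j ∧ μ i + t * i = μ j + t * j}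
  have hB : B.Finite := by
    refine Set.finite_iUnion fun i => Set.finite_iUnion fun j => ?_
    refine Set.Subsingleton.finite ?_
    rintro s ⟨hij, hs⟩ t ⟨-, ht⟩
    have hij' : ((i : ℕ) : ℝ) - ((j : ℕ) : ℝ) ≠ 0 := by
      rw [sub_ne_zero]
      exact fun h => hij (Fin.ext (by exact_mod_cast h))
    have : (s - t) * (((i : ℕ) : ℝ) - ((j : ℕ) : ℝ)) = 0 := by linear_combination hs - ht
    exact sub_eq_zero.1 ((mul_eq_zero.1 this).resolve_right hij')
  have hd : Dense Bᶜ := hB.countable.dense_compl ℝ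
  have hg : Continuous (fun t : ℝ => f (fun i => μ i + t * i)) := by
    refine hf.comp (continuous_pi fun i => ?_)
    fun_prop
  have := Continuous.ext_on hd hg (continuous_const (y := (0 : ℝ))) fun t ht => by
    refine h0 _ fun i j hij => ?_
    by_contra hne
    exact ht (Set.mem_iUnion.2 ⟨i, Set.mem_iUnion.2 ⟨j, hne, hij⟩⟩)
  simpa using congrFun this 0

namespace IsFrame

variable {c : Fin E.rank → W} (h : E.IsFrame c)
include h

/-- For distinct eigenvalues this is the constant coefficient of `charPoly_eq_nodal`; continuity in
`μ` covers repeated ones. -/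
theorem det_combo (μ : Fin E.rank → ℝ) : E.det (∑ i, μ i • c i) = ∏ i, μ i := by
  rw [← sub_eq_zero]
  refine Continuous.eq_zero_of_injective (f := fun μ => E.det (∑ i, μ i • c i) - ∏ i, μ i) ?_ ?_ μ
  · refine Continuous.sub ((continuous_evalAt (E.charCoeffs E.rank)).comp ?_) ?_ <;> fun_prop
  · intro μ hμ
    rw [sub_eq_zero]
    have h1 := congrArg (fun p => Polynomial.coeff p (E.rank - E.rank)) (h.charPoly_eq_nodal hμ)
    simp only [charPoly] at h1
    rw [coeff_sum_monomial_sub _ _ le_rfl, Nat.sub_self, Polynomial.coeff_zero_eq_eval_zero,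
      Lagrange.eval_nodal] at h1
    simp only [zero_sub, Finset.prod_neg, Finset.card_univ, Fintype.card_fin] at h1
    exact mul_left_cancel₀ (pow_ne_zero _ (by norm_num)) h1

theorem fderiv_det_combo (μ : Fin E.rank → ℝ) (w : W) :
    fderiv ℝ E.det (∑ i, μ i • c i) w = ∑ j, coord (c j) w * ∏ i ∈ Finset.univ.erase j, μ i := by
  rw [← sub_eq_zero]
  refine Continuous.eq_zero_of_injective (f := fun μ => fderiv ℝ E.det (∑ i, μ i • c i) w -
    ∑ j, coord (c j) w * ∏ i ∈ Finset.univ.erase j, μ i) ?_ ?_ μ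
  · refine Continuous.sub ((continuous_fderiv_evalAt (E.charCoeffs E.rank) w).comp ?_) ?_ <;>
      fun_prop
  · intro μ hμ
    rw [sub_eq_zero]
    have h1 := congrArg (fun p => Polynomial.coeff p (E.rank - E.rank)) (h.charPolyDeriv_eq hμ w)
    simp only [charPolyDeriv] at h1
    rw [coeff_sum_monomial_sub _ _ le_rfl, Nat.sub_self, Polynomial.coeff_zero_eq_eval_zero,
      Polynomial.eval_neg, Polynomial.eval_finsetSum] at h1
    have h2 : ∀ j, (Polynomial.C (coord (c j) w) * Lagrange.nodal (Finset.univ.erase j) μ).eval 0 =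
        -((-1) ^ E.rank * (coord (c j) w * ∏ i ∈ Finset.univ.erase j, μ i)) := by
      intro j
      rw [Polynomial.eval_mul, Polynomial.eval_C, Lagrange.eval_nodal]
      simp only [zero_sub, Finset.prod_neg, Finset.card_erase_of_mem (Finset.mem_univ j),
        Finset.card_univ, Fintype.card_fin]
      obtain ⟨r, hr⟩ : ∃ r, E.rank = r + 1 := ⟨E.rank - 1, by have := E.rank_pos; omega⟩
      rw [show E.rank - 1 = r by omega, show (-1 : ℝ) ^ E.rank = -(-1) ^ r by rw [hr]; ring]
      ring
    rw [Finset.sum_congr rfl fun j _ => h2 j, Finset.sum_neg_distrib, neg_neg, ← Finset.mul_sum]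
      at h1
    exact mul_left_cancel₀ (pow_ne_zero _ (by norm_num)) h1

end IsFrame

end Derivatives

end EuclideanJordanAlgebra

/-! ### The cone of squares -/

namespace EuclideanJordanAlgebra

variable {W : Type*} [NormedAddCommGroup W] [InnerProductSpace ℝ W] (E : EuclideanJordanAlgebra W)

section Cone

theorem inner_one_idem {c : W} (hc : E.mul c c = c) : inner ℝ E.one c = ‖c‖ ^ 2 := by
  rw [← real_inner_self_eq_norm_sq]
  conv_lhs => rw [← hc, E.inner_mul_right, E.mul_one]

/-- `⟨x ∘ x, c⟩ = ⟨c ∘ x, x⟩`, and `L_c` is positive semidefinite. -/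
theorem inner_nonneg_of_mem_cone {w c : W} (hw : w ∈ E.cone) (hc : E.mul c c = c) :
    0 ≤ inner ℝ w c := by
  obtain ⟨x, rfl⟩ := hw
  have := E.inner_idem_mul_nonneg hc x
  rwa [E.inner_mul_left, E.mul_comm x c, real_inner_comm]

theorem IsFrame.combo_mem_cone {E : EuclideanJordanAlgebra W} {c : Fin E.rank → W}
    (h : E.IsFrame c) {μ : Fin E.rank → ℝ} (hμ : ∀ j, 0 ≤ μ j) : ∑ i, μ i • c i ∈ E.cone := by
  refine ⟨∑ i, Real.sqrt (μ i) • c i, ?_⟩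
  simp only [h.combo_mul_combo, Real.mul_self_sqrt (hμ _)]

variable [FiniteDimensional ℝ W] [Nontrivial W]

/-- Conversely, testing on a frame of `w` makes its eigenvalues nonnegative, and these have square
roots. As an intersection of half-spaces, the cone is closed and convex. -/
theorem mem_cone_iff {w : W} : w ∈ E.cone ↔ ∀ c, E.mul c c = c → 0 ≤ inner ℝ w c := by
  refine ⟨fun hw c hc => E.inner_nonneg_of_mem_cone hw hc, fun hw => ?_⟩
  obtain ⟨c, h, μ, rfl⟩ := E.exists_isFrame w
  refine h.combo_mem_cone fun j => ?_
  have := hw (c j) (h.idem j)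
  rw [h.inner_combo] at this
  exact nonneg_of_mul_nonneg_left this (h.norm_sq_pos j)

theorem cone_eq : E.cone = ⋂ (c : W) (_ : E.mul c c = c), {w | 0 ≤ inner ℝ w c} := by
  ext w
  simp [E.mem_cone_iff]

theorem isClosed_cone : IsClosed E.cone := by
  rw [cone_eq]
  refine isClosed_iInter fun c => isClosed_iInter fun _ => ?_
  exact isClosed_le continuous_const (continuous_id.inner continuous_const)

theorem convex_cone : Convex ℝ E.cone := by
  rw [cone_eq]
  refine convex_iInter fun c => convex_iInter fun _ => ?_
  intro x hx y hy a b ha hb _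
  simp only [Set.mem_ofPred_eq, inner_add_left, inner_smul_left, RCLike.conj_to_real] at *
  positivity

theorem inner_nonneg_of_mem_cone_of_mem_cone {w z : W} (hw : w ∈ E.cone) (hz : z ∈ E.cone) :
    0 ≤ inner ℝ w z := by
  obtain ⟨c, h, μ, rfl⟩ := E.exists_isFrame z
  rw [inner_sum]
  refine Finset.sum_nonneg fun j _ => ?_
  rw [inner_smul_right]
  have h1 := E.inner_nonneg_of_mem_cone hz (h.idem j)
  rw [h.inner_combo] at h1
  exact mul_nonneg (nonneg_of_mul_nonneg_left h1 (h.norm_sq_pos j))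
    (E.inner_nonneg_of_mem_cone hw (h.idem j))

/-- The cone of squares is self-dual. -/
theorem innerDual_cone : (ProperCone.innerDual E.cone : Set W) = E.cone := by
  ext z
  rw [SetLike.mem_coe, ProperCone.mem_innerDual]
  refine ⟨fun h => ?_, fun hz x hx => E.inner_nonneg_of_mem_cone_of_mem_cone hx hz⟩
  rw [mem_cone_iff]
  intro c hc
  rw [real_inner_comm]
  exact h ⟨c, hc⟩

variable {E}

theorem IsFrame.combo_mem_interior_iff {c : Fin E.rank → W} (h : E.IsFrame c)
    {μ : Fin E.rank → ℝ} : ∑ i, μ i • c i ∈ interior E.cone ↔ ∀ j, 0 < μ j := by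
  constructor
  · intro hy j
    have hcont : Filter.Tendsto (fun s : ℝ => (∑ i, μ i • c i) - s • E.one) (nhds 0)
        (nhds (∑ i, μ i • c i)) := by
      have : Continuous (fun s : ℝ => (∑ i, μ i • c i) - s • E.one) := by fun_prop
      simpa using this.tendsto 0
    have h1 := hcont (mem_interior_iff_mem_nhds.1 hy)
    obtain ⟨ε, hε, hball⟩ := Metric.mem_nhds_iff.1 h1
    have h2 : (∑ i, μ i • c i) - (ε / 2) • E.one ∈ E.cone :=
      hball (by rw [Metric.mem_ball, Real.dist_eq, sub_zero, abs_of_pos (by positivity)]; linarith)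
    have h3 := E.inner_nonneg_of_mem_cone h2 (h.idem j)
    rw [inner_sub_left, h.inner_combo, inner_smul_left, E.inner_one_idem (h.idem j),
      RCLike.conj_to_real, ← sub_mul] at h3
    have := nonneg_of_mul_nonneg_left h3 (h.norm_sq_pos j)
    linarith
  · intro hμ
    have : Nonempty (Fin E.rank) := ⟨⟨0, E.rank_pos⟩⟩
    obtain ⟨k, hk⟩ := Finite.exists_min μ
    obtain ⟨δ, hδ, hδc⟩ := E.exists_norm_idem_ge
    rw [mem_interior_iff_mem_nhds, Metric.mem_nhds_iff]
    -- With `μ k` the least eigenvalue, `⟨y, d⟩ ≥ μ k ‖d‖² ≥ μ k δ ‖d‖` for every nonzero idempotent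
    -- `d`, so a perturbation smaller than `μ k δ` keeps all these products nonnegative.
    refine ⟨μ k * δ, mul_pos (hμ k) hδ, fun z hz => ?_⟩
    rw [mem_cone_iff]
    intro d hd
    by_cases hd0 : d = 0
    · simp [hd0]
    rw [Metric.mem_ball, dist_eq_norm] at hz
    have h1 : (∑ i, μ i • c i) - μ k • E.one ∈ E.cone := by
      rw [← h.sum_eq, Finset.smul_sum, ← Finset.sum_sub_distrib]
      simp only [← sub_smul]
      exact h.combo_mem_cone fun j => sub_nonneg.2 (hk j)
    have h2 := E.inner_nonneg_of_mem_cone h1 hd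
    rw [inner_sub_left, inner_smul_left, E.inner_one_idem hd, RCLike.conj_to_real] at h2
    have h3 := abs_le.1 (abs_real_inner_le_norm (z - ∑ i, μ i • c i) d)
    rw [inner_sub_left] at h3
    have h4 := hδc d hd hd0
    have h5 : ‖z - ∑ i, μ i • c i‖ * ‖d‖ ≤ μ k * ‖d‖ * ‖d‖ := by
      have := hμ k
      gcongr
      exact hz.le.trans (by gcongr)
    nlinarith [h3.1]

variable (E)

theorem one_mem_interior : E.one ∈ interior E.cone := by
  obtain ⟨c, h, -⟩ := E.exists_isFrame 0
  rw [h.one_eq_combo, h.combo_mem_interior_iff]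
  exact fun _ => one_pos

theorem det_pos {y : W} (hy : y ∈ interior E.cone) : 0 < E.det y := by
  obtain ⟨c, h, μ, rfl⟩ := E.exists_isFrame y
  rw [h.det_combo]
  exact Finset.prod_pos fun j _ => h.combo_mem_interior_iff.1 hy j

theorem mem_interior_of_det_ne_zero {y : W} (hy : y ∈ E.cone) (hd : E.det y ≠ 0) :
    y ∈ interior E.cone := by
  obtain ⟨c, h, μ, rfl⟩ := E.exists_isFrame y
  rw [h.det_combo, Finset.prod_ne_zero_iff] at hd
  rw [h.combo_mem_interior_iff]
  intro j
  have h1 := E.inner_nonneg_of_mem_cone hy (h.idem j)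
  rw [h.inner_combo] at h1
  exact lt_of_le_of_ne (nonneg_of_mul_nonneg_left h1 (h.norm_sq_pos j))
    (hd j (Finset.mem_univ j)).symm

theorem add_smul_one_mem_interior {w : W} (hw : w ∈ E.cone) {ε : ℝ} (hε : 0 < ε) :
    w + ε • E.one ∈ interior E.cone := by
  obtain ⟨c, h, μ, rfl⟩ := E.exists_isFrame w
  rw [← h.sum_eq, Finset.smul_sum, ← Finset.sum_add_distrib]
  simp only [← add_smul]
  rw [h.combo_mem_interior_iff]
  intro j
  have h1 := E.inner_nonneg_of_mem_cone hw (h.idem j)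
  rw [h.inner_combo] at h1
  have := nonneg_of_mul_nonneg_left h1 (h.norm_sq_pos j)
  linarith

end Cone

/-! ### Inverse and gradient of the log-determinant -/

section LogDet

variable {E}

namespace IsFrame

variable {c : Fin E.rank → W} (h : E.IsFrame c)
include h

theorem polyEval_combo (μ : Fin E.rank → ℝ) (p : Polynomial ℝ) :
    E.polyEval (∑ i, μ i • c i) p = ∑ i, p.eval (μ i) • c i := by
  simp only [polyEval, h.pow_combo, Polynomial.sum, Polynomial.eval_eq_sum, Finset.smul_sum,
    Finset.sum_smul, smul_smul]
  exact Finset.sum_comm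

theorem coord_nonneg {w : W} (hw : w ∈ E.cone) (j : Fin E.rank) : 0 ≤ coord (c j) w :=
  div_nonneg (E.inner_nonneg_of_mem_cone hw (h.idem j)) (h.norm_sq_pos j).le

/-- Interpolating `t⁻¹` on the set of eigenvalues gives an inverse that is a polynomial in `x`. Any
inverse in the span of the powers is a combination of the frame, and its coefficients are then
forced. -/
theorem inv_combo {μ : Fin E.rank → ℝ} (hμ : ∀ j, μ j ≠ 0) :
    E.inv (∑ i, μ i • c i) = ∑ i, (μ i)⁻¹ • c i := by
  classical
  have hex : ∃ y ∈ Submodule.span ℝ (Set.range (E.pow (∑ i, μ i • c i))),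
      E.mul (∑ i, μ i • c i) y = E.one := by
    let p := Lagrange.interpolate (Finset.univ.image μ) id fun t : ℝ => t⁻¹
    refine ⟨_, E.polyEval_mem_span _ p, ?_⟩
    rw [h.polyEval_combo, h.combo_mul_combo, h.one_eq_combo]
    refine Finset.sum_congr rfl fun j _ => ?_
    have h1 : p.eval (μ j) = (μ j)⁻¹ := Lagrange.eval_interpolate_at_node (fun t : ℝ => t⁻¹)
      (v := id) Function.injective_id.injOn (Finset.mem_image_of_mem μ (Finset.mem_univ j))
    rw [h1, mul_inv_cancel₀ (hμ j)]
  rw [inv, dif_pos hex]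
  obtain ⟨hmem, hmul⟩ := hex.choose_spec
  have hle : Submodule.span ℝ (Set.range (E.pow (∑ i, μ i • c i))) ≤
      Submodule.span ℝ (Set.range c) := by
    rw [Submodule.span_le]
    rintro _ ⟨k, rfl⟩
    rw [h.pow_combo]
    exact Submodule.sum_mem _ fun j _ => Submodule.smul_mem _ _ (Submodule.subset_span ⟨j, rfl⟩)
  obtain ⟨ν, hν⟩ := (Submodule.mem_span_range_iff_exists_fun ℝ).1 (hle hmem)
  rw [← hν] at hmul ⊢
  refine Finset.sum_congr rfl fun j _ => ?_
  have h2 := congrArg (coord (c j)) hmul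
  rw [h.combo_mul_combo, h.coord_combo, h.one_eq_combo, h.coord_combo] at h2
  rw [eq_inv_of_mul_eq_one_right h2]

/-- Otherwise all coordinates vanish, so `⟨w, e⟩ = 0`; for `w = x ∘ x` this is `‖x‖² = 0`. -/
theorem exists_coord_pos {w : W} (hw : w ∈ E.cone) (hw0 : w ≠ 0) : ∃ j, 0 < coord (c j) w := by
  by_contra! hle
  have h0 : ∀ j, inner ℝ w (c j) = 0 := fun j => by
    rw [h.inner_eq_coord, le_antisymm (hle j) (h.coord_nonneg hw j), zero_mul]
  have h1 : inner ℝ w E.one = 0 := by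
    rw [← h.sum_eq, inner_sum]
    exact Finset.sum_eq_zero fun j _ => h0 j
  obtain ⟨x, rfl⟩ := hw
  simp only [E.inner_mul_left, E.mul_one, inner_self_eq_zero] at h1
  exact hw0 (by simp [h1])

end IsFrame

variable [FiniteDimensional ℝ W] [Nontrivial W]

namespace IsFrame

variable {c : Fin E.rank → W} (h : E.IsFrame c)
include h

theorem tr_inv_combo_mul {μ : Fin E.rank → ℝ} (hμ : ∀ j, μ j ≠ 0) (w : W) :
    E.tr (E.mul (E.inv (∑ i, μ i • c i)) w) = ∑ j, coord (c j) w / μ j := by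
  rw [h.inv_combo hμ, h.tr_eq]
  refine Finset.sum_congr rfl fun j _ => ?_
  rw [h.coord_combo_mul, div_eq_inv_mul]

end IsFrame

variable (E)

theorem fderiv_det_apply {y : W} (hy : y ∈ interior E.cone) (w : W) :
    fderiv ℝ E.det y w = E.det y * E.tr (E.mul (E.inv y) w) := by
  obtain ⟨c, h, μ, rfl⟩ := E.exists_isFrame y
  have hμ := h.combo_mem_interior_iff.1 hy
  rw [h.fderiv_det_combo, h.det_combo, h.tr_inv_combo_mul fun j => (hμ j).ne', Finset.mul_sum]
  refine Finset.sum_congr rfl fun j _ => ?_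
  rw [← Finset.mul_prod_erase _ _ (Finset.mem_univ j)]
  have := (hμ j).ne'
  field_simp

theorem hasFDerivAt_logDet {y : W} (hy : y ∈ interior E.cone) :
    HasFDerivAt E.logDet ((E.rank : ℝ)⁻¹ • (E.det y)⁻¹ • fderiv ℝ E.det y) y :=
  (((differentiable_evalAt _ y).hasFDerivAt (f := E.det)).log (E.det_pos hy).ne').const_mul _

theorem inner_gradient_logDet {y : W} (hy : y ∈ interior E.cone) (w : W) :
    inner ℝ (∇ E.logDet y) w = (E.rank : ℝ)⁻¹ * E.tr (E.mul (E.inv y) w) := by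
  rw [gradient, InnerProductSpace.toDual_symm_apply, (E.hasFDerivAt_logDet hy).fderiv]
  simp only [_root_.smul_apply, smul_eq_mul, E.fderiv_det_apply hy]
  rw [inv_mul_cancel_left₀ (E.det_pos hy).ne']

theorem tr_inv_mul_pos {w y : W} (hw : w ∈ E.cone) (hw0 : w ≠ 0) (hy : y ∈ interior E.cone) :
    0 < E.tr (E.mul (E.inv y) w) := by
  obtain ⟨c, h, μ, rfl⟩ := E.exists_isFrame y
  have hμ := h.combo_mem_interior_iff.1 hy
  rw [h.tr_inv_combo_mul fun j => (hμ j).ne']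
  obtain ⟨j, hj⟩ := h.exists_coord_pos hw hw0
  exact Finset.sum_pos' (fun i _ => div_nonneg (h.coord_nonneg hw i) (hμ i).le)
    ⟨j, Finset.mem_univ j, div_pos hj (hμ j)⟩

end LogDet

end EuclideanJordanAlgebra

/-! ### Log-convexity of sums of reciprocals, and gradients in coordinates -/

/-- A sum of nonnegative multiples of reciprocals of positive affine functions is log-convex. -/
theorem Real.log_sum_div_le {ι : Type*} (s : Finset ι) {α p q : ι → ℝ} {a b : ℝ}
    (hα : ∀ i ∈ s, 0 ≤ α i) (hα' : ∃ i ∈ s, 0 < α i) (hp : ∀ i ∈ s, 0 < p i)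
    (hq : ∀ i ∈ s, 0 < q i) (ha : 0 ≤ a) (hb : 0 ≤ b) (hab : a + b = 1) :
    Real.log (∑ i ∈ s, α i / (a * p i + b * q i)) ≤
      a * Real.log (∑ i ∈ s, α i / p i) + b * Real.log (∑ i ∈ s, α i / q i) := by
  obtain ⟨k, hk, hαk⟩ := hα'
  have hP : 0 < ∑ i ∈ s, α i / p i := Finset.sum_pos'
    (fun i hi => div_nonneg (hα i hi) (hp i hi).le) ⟨k, hk, div_pos hαk (hp k hk)⟩
  have hQ : 0 < ∑ i ∈ s, α i / q i := Finset.sum_pos'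
    (fun i hi => div_nonneg (hα i hi) (hq i hi).le) ⟨k, hk, div_pos hαk (hq k hk)⟩
  have hr : ∀ i ∈ s, 0 < a * p i + b * q i := by
    intro i hi
    have h := Real.geom_mean_le_arith_mean2_weighted ha hb (hp i hi).le (hq i hi).le hab
    have := hp i hi
    have := hq i hi
    exact lt_of_lt_of_le (by positivity) h
  have hR : 0 < ∑ i ∈ s, α i / (a * p i + b * q i) := Finset.sum_pos'
    (fun i hi => div_nonneg (hα i hi) (hr i hi).le) ⟨k, hk, div_pos hαk (hr k hk)⟩
  set P := ∑ i ∈ s, α i / p i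
  set Q := ∑ i ∈ s, α i / q i
  -- Weighted AM–GM is used twice: on the denominator, and on the reciprocals normalized by `P` and
  -- `Q`. Summation then gives Hölder's bound `P ^ a * Q ^ b`.
  have key : ∀ i ∈ s, α i / (a * p i + b * q i) ≤
      P ^ a * Q ^ b * (a * (α i / p i / P) + b * (α i / q i / Q)) := by
    intro i hi
    have hp := hp i hi
    have hq := hq i hi
    have h1 := Real.geom_mean_le_arith_mean2_weighted ha hb hp.le hq.le hab
    have h2 := Real.geom_mean_le_arith_mean2_weighted ha hb
      (p₁ := (p i)⁻¹ * P⁻¹) (p₂ := (q i)⁻¹ * Q⁻¹) (by positivity) (by positivity) hab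
    rw [Real.mul_rpow (by positivity) (by positivity), Real.mul_rpow (by positivity) (by positivity),
      Real.inv_rpow hp.le, Real.inv_rpow hq.le, Real.inv_rpow hP.le, Real.inv_rpow hQ.le] at h2
    have h3 : (a * p i + b * q i)⁻¹ ≤ (p i ^ a * q i ^ b)⁻¹ := inv_anti₀ (by positivity) h1
    have h4 : (p i ^ a * q i ^ b)⁻¹ = P ^ a * Q ^ b *
        ((p i ^ a)⁻¹ * (P ^ a)⁻¹ * ((q i ^ b)⁻¹ * (Q ^ b)⁻¹)) := by
      have := Real.rpow_pos_of_pos hP a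
      have := Real.rpow_pos_of_pos hQ b
      field_simp
    calc α i / (a * p i + b * q i) = α i * (a * p i + b * q i)⁻¹ := div_eq_mul_inv _ _
      _ ≤ α i * (P ^ a * Q ^ b * (a * ((p i)⁻¹ * P⁻¹) + b * ((q i)⁻¹ * Q⁻¹))) := by
        refine mul_le_mul_of_nonneg_left (h3.trans (h4.le.trans ?_)) (hα i hi)
        exact mul_le_mul_of_nonneg_left h2 (by positivity)
      _ = _ := by ring
  have hsum : ∑ i ∈ s, α i / (a * p i + b * q i) ≤ P ^ a * Q ^ b := by
    refine (Finset.sum_le_sum key).trans (le_of_eq ?_)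
    rw [← Finset.mul_sum, Finset.sum_add_distrib, ← Finset.mul_sum, ← Finset.mul_sum,
      ← Finset.sum_div, ← Finset.sum_div, div_self hP.ne', div_self hQ.ne', mul_one, mul_one, hab,
      mul_one]
  calc Real.log (∑ i ∈ s, α i / (a * p i + b * q i)) ≤ Real.log (P ^ a * Q ^ b) :=
        Real.log_le_log hR hsum
    _ = _ := by
      rw [Real.log_mul (Real.rpow_pos_of_pos hP a).ne' (Real.rpow_pos_of_pos hQ b).ne',
        Real.log_rpow hP, Real.log_rpow hQ]

theorem NormedSpace.exp_apply_of_apply_eq_smul {V : Type*} [NormedAddCommGroup V] [NormedSpace ℝ V]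
    [CompleteSpace V] {T : V →L[ℝ] V} {v : V} {l : ℝ} (h : T v = l • v) :
    NormedSpace.exp T v = Real.exp l • v := by
  have hp : ∀ n : ℕ, (T ^ n) v = l ^ n • v := by
    intro n
    induction n with
    | zero => simp
    | succ n ih => rw [pow_succ', mul_apply_eq_comp, ih, map_smul, h, smul_smul, pow_succ]
  have h1 := (NormedSpace.exp_series_hasSum_exp' (𝕂 := ℝ) T).mapL
    (ContinuousLinearMap.apply ℝ V v)
  have h2 := (NormedSpace.exp_series_hasSum_exp' (𝕂 := ℝ) l).smul_const v
  rw [Real.exp_eq_exp_ℝ]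
  refine h1.unique ?_
  simpa [hp, smul_smul] using h2

theorem EuclideanSpace.gradient_apply {n : ℕ} (F : EuclideanSpace ℝ (Fin n) → ℝ)
    (x : EuclideanSpace ℝ (Fin n)) (i : Fin n) :
    (∇ F x) i = fderiv ℝ F x (EuclideanSpace.single i 1) := by
  have h : ∀ z : EuclideanSpace ℝ (Fin n), z i = inner ℝ z (EuclideanSpace.single i 1) := by
    simp [EuclideanSpace.inner_single_right]
  rw [h, gradient, InnerProductSpace.toDual_symm_apply]

/-- Gradient log-convexity in terms of partial derivatives. -/
theorem GradientLogConvex.of_fderiv {n : ℕ} {F : EuclideanSpace ℝ (Fin n) → ℝ}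
    {g : Fin n → EuclideanSpace ℝ (Fin n) → ℝ}
    (hF : ∀ x : EuclideanSpace ℝ (Fin n), (∀ i, 0 < x i) → DifferentiableAt ℝ F x)
    (hg : ∀ x : EuclideanSpace ℝ (Fin n), (∀ i, 0 < x i) → ∀ i,
      fderiv ℝ F x (EuclideanSpace.single i 1) = g i x)
    (hpos : ∀ x : EuclideanSpace ℝ (Fin n), (∀ i, 0 < x i) → ∀ i, 0 < g i x)
    (hconv : ∀ x y : EuclideanSpace ℝ (Fin n), (∀ i, 0 < x i) → (∀ i, 0 < y i) → ∀ s t : ℝ,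
      0 ≤ s → 0 ≤ t → s + t = 1 → ∀ i,
      Real.log (g i (s • x + t • y)) ≤ s * Real.log (g i x) + t * Real.log (g i y)) :
    GradientLogConvex F := by
  refine ⟨fun x hx => ⟨hF x hx, fun i => ?_⟩, fun x y hx _ hy _ t ht0 ht1 i => ?_⟩
  · rw [EuclideanSpace.gradient_apply, hg x hx]
    exact hpos x hx i
  · have hxy : ∀ i, 0 < (t • x + (1 - t) • y) i := fun i => by
      simpa using convex_Ioi (0 : ℝ) (hx i) (hy i) ht0 (sub_nonneg.2 ht1) (by ring)
    simp only [EuclideanSpace.gradient_apply, hg x hx, hg y hy, hg _ hxy]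
    exact hconv x y hx hy t (1 - t) ht0 (sub_nonneg.2 ht1) (by ring) i

/-! ### Exponentials of multiplications and the convexity theorem -/

namespace EuclideanJordanAlgebra

variable {W : Type*} [NormedAddCommGroup W] [InnerProductSpace ℝ W] (E : EuclideanJordanAlgebra W)
variable [FiniteDimensional ℝ W]

/-- The one-parameter family of automorphisms of the cone generated by multiplication by `a`. -/
noncomputable def expMul (a : W) : W →L[ℝ] W := NormedSpace.exp (E.mulL a)

theorem expMul_neg_apply (a x : W) : E.expMul a (E.expMul (-a) x) = x := by
  let _ : NormedAlgebra ℚ (W →L[ℝ] W) := NormedAlgebra.restrictScalars ℚ ℝ _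
  have h : NormedSpace.exp (E.mulL a) * NormedSpace.exp (E.mulL (-a)) = 1 := by
    rw [← NormedSpace.exp_add_of_commute, map_neg, add_neg_cancel, NormedSpace.exp_zero]
    rw [map_neg]
    exact (Commute.refl _).neg_right
  exact congrArg (fun T : W →L[ℝ] W => T x) h

variable [Nontrivial W]

theorem fderiv_det_mul (a y : W) : fderiv ℝ E.det y (E.mul a y) = E.tr a * E.det y := by
  obtain ⟨c, h, μ, rfl⟩ := E.exists_isFrame y
  rw [h.fderiv_det_combo, h.det_combo, h.tr_eq, Finset.sum_mul]
  refine Finset.sum_congr rfl fun j _ => ?_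
  rw [E.mul_comm, h.coord_combo_mul, ← Finset.mul_prod_erase _ _ (Finset.mem_univ j)]
  ring

theorem tr_smul (t : ℝ) (a : W) : E.tr (t • a) = t * E.tr a := by
  rw [tr, evalAt_smul_of_isHomogeneous (E.isCharCoeffs_charCoeffs.2.1 1), pow_one, tr]

/-- By `fderiv_det_mul`, `exp(-s tr a) det(exp(s L_a) y)` has zero derivative in `s`. -/
theorem det_expMul (a y : W) : E.det (E.expMul a y) = Real.exp (E.tr a) * E.det y := by
  have hexp : ∀ s : ℝ, HasDerivAt (fun s : ℝ => NormedSpace.exp (s • E.mulL a) y)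
      (E.mul a (NormedSpace.exp (s • E.mulL a) y)) s := by
    intro s
    have h := (hasDerivAt_exp_smul_const' (𝕂 := ℝ) (E.mulL a) s).clm_apply (hasDerivAt_const s y)
    simpa [mulL_apply] using h
  have hdet : ∀ s : ℝ, HasDerivAt (fun s : ℝ => Real.exp (-(s * E.tr a)) *
      E.det (NormedSpace.exp (s • E.mulL a) y)) 0 s := by
    intro s
    have h1 := ((differentiable_evalAt _ _).hasFDerivAt (f := E.det)).comp_hasDerivAt s (hexp s)
    have h2 := (((hasDerivAt_id s).mul_const (E.tr a)).neg.exp).mul h1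
    refine h2.congr_deriv ?_
    simp only [Function.comp_apply, fderiv_det_mul, id]
    ring
  have hconst := is_const_of_deriv_eq_zero (fun s => (hdet s).differentiableAt)
    (fun s => (hdet s).deriv) 1 0
  simp only [one_smul, zero_smul, NormedSpace.exp_zero, one_apply_eq_self, _root_.one_mul,
    zero_mul, neg_zero, Real.exp_zero, Real.exp_neg] at hconst
  rw [expMul, ← hconst, mul_inv_cancel_left₀ (Real.exp_pos _).ne']

theorem fderiv_det_expMul (a y w : W) :
    fderiv ℝ E.det (E.expMul a y) (E.expMul a w) = Real.exp (E.tr a) * fderiv ℝ E.det y w := by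
  have h1 := ((differentiable_evalAt _ (E.expMul a y)).hasFDerivAt (f := E.det)).comp y
    (E.expMul a).hasFDerivAt
  have h2 := ((differentiable_evalAt _ y).hasFDerivAt (f := E.det)).const_mul (Real.exp (E.tr a))
  have h3 : E.det ∘ E.expMul a = fun y => Real.exp (E.tr a) * E.det y :=
    funext fun y => E.det_expMul a y
  rw [h3] at h1
  exact congrArg (fun T : W →L[ℝ] ℝ => T w) (h1.unique h2)

/-- The path `exp(s L_a) y` starts in the interior and `det` never vanishes on it. Points of the
cone outside its interior have determinant zero, so the connected path cannot leave. -/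
theorem expMul_mem_interior (a : W) {y : W} (hy : y ∈ interior E.cone) :
    E.expMul a y ∈ interior E.cone := by
  let γ : ℝ → W := fun s => E.expMul (s • a) y
  have hγ : Continuous γ := by
    let _ : NormedAlgebra ℚ (W →L[ℝ] W) := NormedAlgebra.restrictScalars ℚ ℝ _
    have h1 : Continuous fun s : ℝ => NormedSpace.exp (E.mulL (s • a)) :=
      NormedSpace.exp_continuous.comp (by fun_prop)
    exact h1.clm_apply continuous_const
  have hpre : IsPreconnected (Set.range γ) := isPreconnected_range hγ
  have hne : ∀ z ∈ Set.range γ, E.det z ≠ 0 := by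
    rintro _ ⟨s, rfl⟩
    simp only [γ, det_expMul]
    exact (mul_pos (Real.exp_pos _) (E.det_pos hy)).ne'
  have hsub : Set.range γ ⊆ interior E.cone := by
    refine hpre.subset_left_of_subset_union (v := E.coneᶜ) isOpen_interior
      E.isClosed_cone.isOpen_compl ?_ ?_ ?_
    · exact Set.disjoint_left.2 fun z hz hz' => hz' (interior_subset hz)
    · intro z hz
      by_cases hzc : z ∈ E.cone
      · exact Or.inl (E.mem_interior_of_det_ne_zero hzc (hne z hz))
      · exact Or.inr hzc
    · refine ⟨y, ⟨0, ?_⟩, hy⟩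
      simp [γ, expMul, NormedSpace.exp_zero]
  exact hsub ⟨1, by simp [γ]⟩

theorem expMul_mem_cone (a : W) {w : W} (hw : w ∈ E.cone) : E.expMul a w ∈ E.cone := by
  have hlim : Filter.Tendsto (fun ε : ℝ => E.expMul a (w + ε • E.one)) (nhdsWithin 0 (Set.Ioi 0))
      (nhds (E.expMul a w)) := by
    have hc : Continuous fun ε : ℝ => E.expMul a (w + ε • E.one) := by fun_prop
    simpa using (hc.tendsto 0).mono_left nhdsWithin_le_nhds
  refine E.isClosed_cone.mem_of_tendsto hlim ?_
  filter_upwards [self_mem_nhdsWithin] with ε hε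
  exact interior_subset (E.expMul_mem_interior a (E.add_smul_one_mem_interior hw hε))

theorem exists_expMul_one_eq {y : W} (hy : y ∈ interior E.cone) : ∃ a, E.expMul a E.one = y := by
  obtain ⟨c, h, μ, rfl⟩ := E.exists_isFrame y
  have hμ := h.combo_mem_interior_iff.1 hy
  -- This is the logarithm of `y`; its multiplication has each `c i` as an eigenvector.
  refine ⟨∑ i, Real.log (μ i) • c i, ?_⟩
  rw [← h.sum_eq, map_sum]
  refine Finset.sum_congr rfl fun j _ => ?_
  rw [expMul, NormedSpace.exp_apply_of_apply_eq_smul (l := Real.log (μ j)), Real.exp_log (hμ j)]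
  rw [mulL_apply, h.combo_mul]

/-- Both sides are logarithmic derivatives of `det`, and `exp(L_a)` changes `det` only by a constant
factor. -/
theorem tr_inv_mul_expMul (a : W) {y : W} (hy : y ∈ interior E.cone) (w : W) :
    E.tr (E.mul (E.inv (E.expMul a y)) (E.expMul a w)) = E.tr (E.mul (E.inv y) w) := by
  have h := E.fderiv_det_expMul a y w
  rw [E.fderiv_det_apply hy, E.fderiv_det_apply (E.expMul_mem_interior a hy), det_expMul,
    ← mul_assoc] at h
  exact mul_left_cancel₀ (mul_pos (Real.exp_pos _) (E.det_pos hy)).ne' h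

theorem convexOn_log_tr_inv_mul {w : W} (hw : w ∈ E.cone) :
    ConvexOn ℝ (interior E.cone) (fun y => Real.log (E.tr (E.mul (E.inv y) w))) := by
  refine ⟨E.convex_cone.interior, fun x hx y hy s t hs ht hst => ?_⟩
  by_cases hw0 : w = 0
  · have : E.tr 0 = 0 := by simpa using E.tr_smul 0 0
    simp [hw0, this]
  -- Transport by `exp(L_a)` so that the segment starts at `e`; the frame of its other end then
  -- diagonalizes every point of it.
  obtain ⟨a, rfl⟩ := E.exists_expMul_one_eq hx
  obtain ⟨z, rfl⟩ : ∃ z, E.expMul a z = y := ⟨_, E.expMul_neg_apply a y⟩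
  obtain ⟨v, rfl⟩ : ∃ v, E.expMul a v = w := ⟨_, E.expMul_neg_apply a w⟩
  have hback : ∀ x, E.expMul (-a) (E.expMul a x) = x := fun x => by
    simpa using E.expMul_neg_apply (-a) x
  have hv : v ∈ E.cone := by rw [← hback v]; exact E.expMul_mem_cone _ hw
  have hz : z ∈ interior E.cone := by rw [← hback z]; exact E.expMul_mem_interior _ hy
  have hv0 : v ≠ 0 := fun h => hw0 (by rw [h, map_zero])
  have hone := E.one_mem_interior
  dsimp only
  rw [← map_smul, ← map_smul, ← map_add,
    E.tr_inv_mul_expMul a (E.convex_cone.interior hone hz hs ht hst), E.tr_inv_mul_expMul a hone,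
    E.tr_inv_mul_expMul a hz]
  obtain ⟨c, h, μ, rfl⟩ := E.exists_isFrame z
  have hμ := h.combo_mem_interior_iff.1 hz
  have hcomb : s • E.one + t • ∑ i, μ i • c i = ∑ i, (s * 1 + t * μ i) • c i := by
    rw [h.one_eq_combo, Finset.smul_sum, Finset.smul_sum, ← Finset.sum_add_distrib]
    exact Finset.sum_congr rfl fun j _ => by rw [smul_smul, smul_smul, add_smul]
  have hpos := h.combo_mem_interior_iff.1
    (hcomb ▸ E.convex_cone.interior hone hz hs ht hst)
  rw [hcomb, h.tr_inv_combo_mul fun j => (hpos j).ne', h.tr_inv_combo_mul fun j => (hμ j).ne',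
    h.one_eq_combo, h.tr_inv_combo_mul fun j => _root_.one_ne_zero]
  obtain ⟨j, hj⟩ := h.exists_coord_pos hv hv0
  exact Real.log_sum_div_le Finset.univ (fun i _ => h.coord_nonneg hv i) ⟨j, Finset.mem_univ j, hj⟩
    (fun _ _ => one_pos) (fun i _ => hμ i) hs ht hst

theorem convexOn_log_inner_gradient {w : W} (hw : w ∈ E.cone) :
    ConvexOn ℝ (interior E.cone) (fun y => Real.log (inner ℝ (∇ E.logDet y) w)) := by
  by_cases hw0 : w = 0
  · simp only [hw0, inner_zero_right]
    exact convexOn_const _ E.convex_cone.interior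
  refine ((E.convexOn_log_tr_inv_mul hw).add_const (Real.log (E.rank : ℝ)⁻¹)).congr
    fun y hy => ?_
  have hr : (0 : ℝ) < (E.rank : ℝ)⁻¹ := inv_pos.2 (Nat.cast_pos.2 E.rank_pos)
  simp only [E.inner_gradient_logDet hy]
  rw [Real.log_mul hr.ne' (E.tr_inv_mul_pos hw hw0 hy).ne', add_comm]
  rfl

theorem gradientLogConvex_logDet_comp {n : ℕ} (A : EuclideanSpace ℝ (Fin n) →ₗ[ℝ] W)
    (h1 : ∀ x : EuclideanSpace ℝ (Fin n), (∀ i, 0 ≤ x i) → A x ∈ E.cone)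
    (h2 : ∀ x : EuclideanSpace ℝ (Fin n), (∀ i, 0 < x i) → A x ∈ interior E.cone)
    (h3 : ∀ z ∈ interior (ProperCone.innerDual E.cone : Set W),
      ∀ i, 0 < (LinearMap.adjoint A z) i) :
    GradientLogConvex (fun x => E.logDet (A x)) := by
  let e : Fin n → EuclideanSpace ℝ (Fin n) := fun i => EuclideanSpace.single i 1
  have hcoord : ∀ (x : EuclideanSpace ℝ (Fin n)) i, x i = inner ℝ x (e i) := by
    intro x i; simp [e, EuclideanSpace.inner_single_right]
  have hmem : ∀ i, A (e i) ∈ E.cone := by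
    intro i
    refine h1 _ fun j => ?_
    by_cases hij : j = i <;> simp [e, hij]
  have hne : ∀ i, A (e i) ≠ 0 := by
    intro i h0
    -- By self-duality `e` is interior to the dual cone, so `⟨e, A eᵢ⟩ > 0` and `A eᵢ ≠ 0`.
    have := h3 E.one (by rw [innerDual_cone]; exact E.one_mem_interior) i
    rw [hcoord, LinearMap.adjoint_inner_left, h0, inner_zero_right] at this
    exact lt_irrefl _ this
  let A' : EuclideanSpace ℝ (Fin n) →L[ℝ] W := LinearMap.toContinuousLinearMap A
  have hfd : ∀ x : EuclideanSpace ℝ (Fin n), (∀ i, 0 < x i) →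
      HasFDerivAt (fun x => E.logDet (A x)) ((fderiv ℝ E.logDet (A x)).comp A') x := by
    intro x hx
    have h4 := (E.hasFDerivAt_logDet (h2 x hx)).differentiableAt.hasFDerivAt
    exact HasFDerivAt.comp (f := A') x h4 A'.hasFDerivAt
  have hr : (0 : ℝ) < (E.rank : ℝ)⁻¹ := inv_pos.2 (Nat.cast_pos.2 E.rank_pos)
  refine .of_fderiv (g := fun i x => inner ℝ (∇ E.logDet (A x)) (A (e i)))
    (fun x hx => (hfd x hx).differentiableAt) (fun x hx i => ?_) (fun x hx i => ?_)
    fun x y hx hy s t hs ht hst i => ?_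
  · rw [(hfd x hx).fderiv, gradient, InnerProductSpace.toDual_symm_apply]
    rfl
  · rw [E.inner_gradient_logDet (h2 x hx)]
    exact mul_pos hr (E.tr_inv_mul_pos (hmem i) (hne i) (h2 x hx))
  · rw [map_add, map_smul, map_smul]
    exact (E.convexOn_log_inner_gradient (hmem i)).2 (h2 x hx) (h2 y hy) hs ht hst

end EuclideanJordanAlgebra

/-! ### Positron emission tomography -/

theorem gradientLogConvex_petObjective {n m : ℕ} {p : Fin n → Fin m → ℝ} {Y : Fin m → ℝ}
    (hp : ∀ i j, 0 ≤ p i j) (hY : ∀ j, 0 ≤ Y j) (hp' : ∀ j, ∃ i, 0 < p i j)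
    (hYp : ∀ i, ∃ j, 0 < Y j * p i j) : GradientLogConvex (petObjective p Y) := by
  have hlin : ∀ x : EuclideanSpace ℝ (Fin n), (∀ i, 0 < x i) → ∀ j, 0 < ∑ i, p i j * x i := by
    intro x hx j
    obtain ⟨i, hi⟩ := hp' j
    exact Finset.sum_pos' (fun k _ => mul_nonneg (hp k j) (hx k).le)
      ⟨i, Finset.mem_univ i, mul_pos hi (hx i)⟩
  -- Positivity needs some index `i`; for `n = 0` the sum may vanish, but there is no coordinate to
  -- check.
  have hS : ∀ _ : Fin n, 0 < (∑ j, Y j)⁻¹ := by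
    intro i
    obtain ⟨j, hj⟩ := hYp i
    exact inv_pos.2 (Finset.sum_pos' (fun k _ => hY k)
      ⟨j, Finset.mem_univ j, pos_of_mul_pos_left hj (hp i j)⟩)
  let L : Fin m → EuclideanSpace ℝ (Fin n) →L[ℝ] ℝ := fun j =>
    ∑ i, p i j • (EuclideanSpace.proj i : EuclideanSpace ℝ (Fin n) →L[ℝ] ℝ)
  have hL : ∀ j x, L j x = ∑ i, p i j * x i := by intro j x; simp [L]
  have hfd : ∀ x : EuclideanSpace ℝ (Fin n), (∀ i, 0 < x i) → HasFDerivAt (petObjective p Y)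
      ((∑ j, Y j)⁻¹ • ∑ j, Y j • (L j x)⁻¹ • L j) x := by
    intro x hx
    have h1 : ∀ j, HasFDerivAt (fun z => Y j * Real.log (L j z)) (Y j • (L j x)⁻¹ • L j) x :=
      fun j => ((L j).hasFDerivAt.log (by rw [hL]; exact (hlin x hx j).ne')).const_mul _
    have h2 := (HasFDerivAt.fun_sum (u := Finset.univ) fun j _ => h1 j).const_mul (∑ j, Y j)⁻¹
    simp only [hL] at h2 ⊢
    exact h2
  have hpos : ∀ x : EuclideanSpace ℝ (Fin n), (∀ i, 0 < x i) → ∀ i,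
      0 < ∑ j, (Y j * p i j) / ∑ k, p k j * x k := by
    intro x hx i
    obtain ⟨j, hj⟩ := hYp i
    exact Finset.sum_pos' (fun k _ => div_nonneg (mul_nonneg (hY k) (hp i k)) (hlin x hx k).le)
      ⟨j, Finset.mem_univ j, div_pos hj (hlin x hx j)⟩
  refine .of_fderiv (g := fun i x => (∑ j, Y j)⁻¹ * ∑ j, (Y j * p i j) / ∑ k, p k j * x k)
    (fun x hx => (hfd x hx).differentiableAt) (fun x hx i => ?_)
    (fun x hx i => mul_pos (hS i) (hpos x hx i)) fun x y hx hy s t hs ht hst i => ?_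
  · have hLe : ∀ j, L j (EuclideanSpace.single i 1) = p i j := fun j => by simp [hL]
    rw [(hfd x hx).fderiv]
    simp only [smul_apply, sum_apply, smul_eq_mul, hLe]
    simp only [hL]
    congr 1
    exact Finset.sum_congr rfl fun j _ => by ring
  · have hxy : ∀ i, 0 < (s • x + t • y) i := fun i => by
      simpa using convex_Ioi (0 : ℝ) (hx i) (hy i) hs ht hst
    have hcomb : ∀ j, ∑ k, p k j * (s • x + t • y) k =
        s * (∑ k, p k j * x k) + t * ∑ k, p k j * y k := by
      intro j; simp only [← hL, map_add, map_smul, smul_eq_mul]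
    have h1 := Real.log_sum_div_le Finset.univ (α := fun j => Y j * p i j)
      (fun j _ => mul_nonneg (hY j) (hp i j)) ((hYp i).imp fun j hj => ⟨Finset.mem_univ j, hj⟩)
      (fun j _ => hlin x hx j) (fun j _ => hlin y hy j) hs ht hst
    rw [Real.log_mul (hS i).ne' (hpos x hx i).ne', Real.log_mul (hS i).ne' (hpos y hy i).ne',
      Real.log_mul (hS i).ne' (hpos _ hxy i).ne']
    simp only [hcomb]
    have h2 : s * Real.log (∑ j, Y j)⁻¹ + t * Real.log (∑ j, Y j)⁻¹ = Real.log (∑ j, Y j)⁻¹ := by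
      rw [← add_mul, hst, one_mul]
    linarith

/-! ### Positive definite matrices and D-optimal design -/

namespace Matrix.PosDef

variable {ι : Type*} [Fintype ι] {A B : Matrix ι ι ℝ}

theorem dotProduct_mulVec_comm (hA : A.PosDef) (u v : ι → ℝ) : u ⬝ᵥ A *ᵥ v = v ⬝ᵥ A *ᵥ u := by
  have h : Aᵀ = A := by simpa using hA.isHermitian.eq
  rw [dotProduct_mulVec, ← mulVec_transpose, h, dotProduct_comm]

variable [DecidableEq ι]

theorem dotProduct_inv_mulVec_pos (hA : A.PosDef) {u : ι → ℝ} (hu : u ≠ 0) :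
    0 < u ⬝ᵥ A⁻¹ *ᵥ u := by simpa using hA.inv.dotProduct_mulVec_pos hu

theorem mulVec_inv_mulVec (hA : A.PosDef) (u : ι → ℝ) : A *ᵥ A⁻¹ *ᵥ u = u := by
  rw [mulVec_mulVec, mul_nonsing_inv _ ((isUnit_iff_isUnit_det A).1 hA.isUnit), one_mulVec]

/-- A Cauchy–Schwarz inequality. -/
theorem sq_dotProduct_le (hA : A.PosDef) (u v : ι → ℝ) :
    (v ⬝ᵥ u) ^ 2 ≤ (u ⬝ᵥ A⁻¹ *ᵥ u) * (v ⬝ᵥ A *ᵥ v) := by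
  by_cases hu : u = 0
  · simp [hu]
  have hφ := hA.dotProduct_inv_mulVec_pos hu
  set w := A⁻¹ *ᵥ u with hw
  have hAw : A *ᵥ w = u := hA.mulVec_inv_mulVec u
  have h1 : ∀ l : ℝ, 0 ≤ v ⬝ᵥ A *ᵥ v - 2 * l * (v ⬝ᵥ u) + l ^ 2 * (u ⬝ᵥ w) := by
    intro l
    have h := hA.posSemidef.dotProduct_mulVec_nonneg (v - l • w)
    have h2 : w ⬝ᵥ A *ᵥ v = v ⬝ᵥ u := by rw [hA.dotProduct_mulVec_comm, hAw]
    simp only [star_trivial, mulVec_sub, mulVec_smul, hAw, sub_dotProduct, dotProduct_sub,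
      smul_dotProduct, dotProduct_smul, smul_eq_mul, h2, dotProduct_comm w u] at h
    linarith
  -- The minimizer of the quadratic in `l`.
  have h2 := h1 ((v ⬝ᵥ u) / (u ⬝ᵥ w))
  have h3 : v ⬝ᵥ A *ᵥ v - 2 * ((v ⬝ᵥ u) / (u ⬝ᵥ w)) * (v ⬝ᵥ u) +
      ((v ⬝ᵥ u) / (u ⬝ᵥ w)) ^ 2 * (u ⬝ᵥ w) = v ⬝ᵥ A *ᵥ v - (v ⬝ᵥ u) ^ 2 / (u ⬝ᵥ w) := by
    field_simp; ring
  rw [h3, sub_nonneg, div_le_iff₀ hφ] at h2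
  linarith

/-- Cauchy–Schwarz makes `(uᵀ A⁻¹ u)⁻¹` the minimum of `vᵀ A v / (v ⬝ u)²`, attained at `v = A⁻¹ u`,
hence concave in `A`. Testing both matrices at the minimizer of their combination gives `h2`;
weighted AM–GM passes to logarithms. -/
theorem log_dotProduct_inv_mulVec_le (hA : A.PosDef) (hB : B.PosDef) {s t : ℝ}
    (hs : 0 ≤ s) (ht : 0 ≤ t) (hst : s + t = 1) (hC : (s • A + t • B).PosDef) {u : ι → ℝ}
    (hu : u ≠ 0) :
    Real.log (u ⬝ᵥ (s • A + t • B)⁻¹ *ᵥ u) ≤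
      s * Real.log (u ⬝ᵥ A⁻¹ *ᵥ u) + t * Real.log (u ⬝ᵥ B⁻¹ *ᵥ u) := by
  have hφA := hA.dotProduct_inv_mulVec_pos hu
  have hφB := hB.dotProduct_inv_mulVec_pos hu
  have hφC := hC.dotProduct_inv_mulVec_pos hu
  set v := (s • A + t • B)⁻¹ *ᵥ u with hv
  have h1 : u ⬝ᵥ v = s * (v ⬝ᵥ A *ᵥ v) + t * (v ⬝ᵥ B *ᵥ v) := by
    have := congrArg (fun z => v ⬝ᵥ z) (hC.mulVec_inv_mulVec u)
    simp only [← hv, add_mulVec, smul_mulVec, dotProduct_add, dotProduct_smul, smul_eq_mul] at this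
    rw [dotProduct_comm, ← this]
  have hAv := hA.sq_dotProduct_le u v
  have hBv := hB.sq_dotProduct_le u v
  rw [dotProduct_comm v u] at hAv hBv
  set a := u ⬝ᵥ A⁻¹ *ᵥ u
  set b := u ⬝ᵥ B⁻¹ *ᵥ u
  set c := u ⬝ᵥ v
  have h2 : s * a⁻¹ + t * b⁻¹ ≤ c⁻¹ := by
    have h3 : c ^ 2 * a⁻¹ ≤ v ⬝ᵥ A *ᵥ v := by
      rw [← div_eq_mul_inv, div_le_iff₀ hφA]; linarith
    have h4 : c ^ 2 * b⁻¹ ≤ v ⬝ᵥ B *ᵥ v := by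
      rw [← div_eq_mul_inv, div_le_iff₀ hφB]; linarith
    have h5 : c * (c * (s * a⁻¹ + t * b⁻¹)) ≤ c * 1 := by
      calc c * (c * (s * a⁻¹ + t * b⁻¹)) = s * (c ^ 2 * a⁻¹) + t * (c ^ 2 * b⁻¹) := by ring
        _ ≤ s * (v ⬝ᵥ A *ᵥ v) + t * (v ⬝ᵥ B *ᵥ v) := by gcongr
        _ = c * 1 := by rw [← h1, mul_one]
    rw [← one_div c, le_div_iff₀ hφC, mul_comm]
    exact le_of_mul_le_mul_left h5 hφC
  have h3 := (Real.geom_mean_le_arith_mean2_weighted hs ht (inv_pos.2 hφA).le (inv_pos.2 hφB).le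
    hst).trans h2
  have h4 := Real.log_le_log (mul_pos (Real.rpow_pos_of_pos (inv_pos.2 hφA) s)
    (Real.rpow_pos_of_pos (inv_pos.2 hφB) t)) h3
  rw [Real.log_mul (Real.rpow_pos_of_pos (inv_pos.2 hφA) s).ne'
    (Real.rpow_pos_of_pos (inv_pos.2 hφB) t).ne', Real.log_rpow (inv_pos.2 hφA),
    Real.log_rpow (inv_pos.2 hφB), Real.log_inv, Real.log_inv, Real.log_inv] at h4
  linarith

theorem det_add_smul_vecMulVec (hA : A.PosDef) (u : ι → ℝ) (t : ℝ) :
    (A + t • vecMulVec u u).det = A.det * (1 + t * (u ⬝ᵥ A⁻¹ *ᵥ u)) := by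
  have h1 : t • vecMulVec u u = replicateCol Unit (t • u) * replicateRow Unit u := by
    rw [← vecMulVec_eq, smul_vecMulVec]
  rw [h1, det_add_replicateCol_mul_replicateRow ((isUnit_iff_isUnit_det A).1 hA.isUnit),
    det_unique (1 + replicateRow Unit u * A⁻¹ * replicateCol Unit (t • u)),
    add_apply, one_apply_eq, Matrix.mul_assoc, ← replicateCol_mulVec,
    replicateRow_mul_replicateCol_apply, mulVec_smul, dotProduct_smul, smul_eq_mul]

end Matrix.PosDef

open Matrix in
theorem gradientLogConvex_dOptObjective {n m : ℕ} {a : Fin m → Fin n → ℝ}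
    (hspan : Submodule.span ℝ (Set.range a) = ⊤) (ha : ∀ i, a i ≠ 0) :
    GradientLogConvex (dOptObjective a) := by
  let M : EuclideanSpace ℝ (Fin m) → Matrix (Fin n) (Fin n) ℝ := fun x =>
    ∑ i, x i • vecMulVec (a i) (a i)
  have hM : ∀ x : EuclideanSpace ℝ (Fin m), (∀ i, 0 < x i) → (M x).PosDef := by
    intro x hx
    refine PosDef.of_dotProduct_mulVec_pos ?_ fun v hv => ?_
    · ext i j
      simp [M, Matrix.sum_apply, vecMulVec_apply, mul_comm]
    · have hq : star v ⬝ᵥ M x *ᵥ v = ∑ i, x i * (a i ⬝ᵥ v) ^ 2 := by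
        simp only [M, star_trivial, sum_mulVec, dotProduct_sum, smul_mulVec, dotProduct_smul,
          vecMulVec_mulVec, smul_eq_mul]
        refine Finset.sum_congr rfl fun i _ => ?_
        rw [op_smul_eq_smul, dotProduct_comm v (a i), smul_eq_mul, sq]
      rw [hq]
      obtain ⟨i, hi⟩ : ∃ i, a i ⬝ᵥ v ≠ 0 := by
        by_contra! h0
        apply hv
        have h1 : ∀ z ∈ Submodule.span ℝ (Set.range a), z ⬝ᵥ v = 0 := by
          intro z hz
          induction hz using Submodule.span_induction with
          | mem z hz => obtain ⟨i, rfl⟩ := hz; exact h0 i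
          | zero => simp
          | add z w _ _ hz hw => rw [add_dotProduct, hz, hw, add_zero]
          | smul r z _ hz => rw [smul_dotProduct, hz, smul_zero]
        exact dotProduct_self_eq_zero.1 (h1 v (by rw [hspan]; trivial))
      refine Finset.sum_pos' (fun k _ => mul_nonneg (hx k).le (sq_nonneg _))
        ⟨i, Finset.mem_univ i, mul_pos (hx i) (by positivity)⟩
  have hn : ∀ _ : Fin m, (0 : ℝ) < (n : ℝ)⁻¹ := by
    intro i
    rcases Nat.eq_zero_or_pos n with rfl | h
    · exact absurd (Subsingleton.elim _ _) (ha i)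
    · positivity
  have hdiff : ∀ x : EuclideanSpace ℝ (Fin m), (∀ i, 0 < x i) →
      DifferentiableAt ℝ (dOptObjective a) x := by
    intro x hx
    have h1 : Differentiable ℝ fun x => (M x).det := by
      simp only [det_apply, M, Matrix.sum_apply, Matrix.smul_apply, smul_eq_mul]
      fun_prop
    exact ((h1 x).log (hM x hx).det_pos.ne').const_mul _
  refine .of_fderiv (g := fun i x => (n : ℝ)⁻¹ * (a i ⬝ᵥ (M x)⁻¹ *ᵥ a i)) hdiff
    (fun x hx i => ?_)
    (fun x hx i => mul_pos (hn i) ((hM x hx).dotProduct_inv_mulVec_pos (ha i)))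
    fun x y hx hy s t hs ht hst i => ?_
  -- Raising the `i`-th weight is a rank-one update, so the determinant is affine along this line.
  · have h2 : HasDerivAt (fun t : ℝ => dOptObjective a (x + t • EuclideanSpace.single i (1 : ℝ)))
        (fderiv ℝ (dOptObjective a) x (EuclideanSpace.single i 1)) 0 :=
      (hdiff x hx).hasFDerivAt.hasLineDerivAt _
    have h3 : (fun t : ℝ => dOptObjective a (x + t • EuclideanSpace.single i (1 : ℝ))) =
        fun t => (n : ℝ)⁻¹ * Real.log ((M x).det * (1 + t * (a i ⬝ᵥ (M x)⁻¹ *ᵥ a i))) := by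
      funext t
      rw [← (hM x hx).det_add_smul_vecMulVec, dOptObjective]
      congr 3
      simp only [M, PiLp.add_apply, PiLp.smul_apply, smul_eq_mul, add_smul, Finset.sum_add_distrib]
      congr 1
      rw [Finset.sum_eq_single i]
      · simp
      · intro j _ hj
        simp [hj]
      · simp
    have hd := (hM x hx).det_pos
    have h4 : HasDerivAt (fun t : ℝ => (n : ℝ)⁻¹ *
        Real.log ((M x).det * (1 + t * (a i ⬝ᵥ (M x)⁻¹ *ᵥ a i))))
        ((n : ℝ)⁻¹ * (a i ⬝ᵥ (M x)⁻¹ *ᵥ a i)) 0 := by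
      have h5 := (((((hasDerivAt_id (0 : ℝ)).mul_const (a i ⬝ᵥ (M x)⁻¹ *ᵥ a i)).const_add
        1).const_mul (M x).det).log (by simpa using hd.ne')).const_mul (n : ℝ)⁻¹
      refine h5.congr_deriv ?_
      simp only [id, zero_mul, add_zero, mul_one, one_mul]
      rw [mul_div_cancel_left₀ _ hd.ne']
    rw [h3] at h2
    exact h2.unique h4
  · have hxy : ∀ i, 0 < (s • x + t • y) i := fun i => by
      simpa using convex_Ioi (0 : ℝ) (hx i) (hy i) hs ht hst
    have hcomb : M (s • x + t • y) = s • M x + t • M y := by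
      simp only [M, PiLp.add_apply, PiLp.smul_apply, smul_eq_mul, add_smul, Finset.sum_add_distrib,
        Finset.smul_sum, smul_smul]
    have h1 := (hM x hx).log_dotProduct_inv_mulVec_le (hM y hy) hs ht hst (hcomb ▸ hM _ hxy) (ha i)
    have hne := fun z hz => ((hM z hz).dotProduct_inv_mulVec_pos (ha i)).ne'
    rw [Real.log_mul (hn i).ne' (hne _ hxy), Real.log_mul (hn i).ne' (hne x hx),
      Real.log_mul (hn i).ne' (hne y hy), hcomb]
    have h2 : s * Real.log (n : ℝ)⁻¹ + t * Real.log (n : ℝ)⁻¹ = Real.log (n : ℝ)⁻¹ := by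
      rw [← add_mul, hst, one_mul]
    linarith

theorem mainTheorem5 :
    (∀ (W : Type*) [NormedAddCommGroup W] [InnerProductSpace ℝ W] [FiniteDimensional ℝ W]
        [Nontrivial W] (E : EuclideanJordanAlgebra W),
      (∀ y ∈ interior E.cone, 0 < E.det y ∧ DifferentiableAt ℝ E.logDet y ∧
        ∀ w, inner ℝ (∇ E.logDet y) w = (E.rank : ℝ)⁻¹ * E.tr (E.mul (E.inv y) w)) ∧
      (∀ w ∈ E.cone,
        (w ≠ 0 → ∀ y ∈ interior E.cone,
          0 < inner ℝ (∇ E.logDet y) w ∧ 0 < E.tr (E.mul (E.inv y) w)) ∧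
        ConvexOn ℝ (interior E.cone) (fun y => Real.log (inner ℝ (∇ E.logDet y) w)) ∧
        ConvexOn ℝ (interior E.cone) (fun y => Real.log (E.tr (E.mul (E.inv y) w)))) ∧
      (∀ (n : ℕ) (A : EuclideanSpace ℝ (Fin n) →ₗ[ℝ] W),
        (∀ x : EuclideanSpace ℝ (Fin n), (∀ i, 0 ≤ x i) → A x ∈ E.cone) →
        (∀ x : EuclideanSpace ℝ (Fin n), (∀ i, 0 < x i) → A x ∈ interior E.cone) →
        (∀ z ∈ interior (ProperCone.innerDual E.cone : Set W),
          ∀ i, 0 < (LinearMap.adjoint A z) i) →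
        GradientLogConvex (fun x => E.logDet (A x)))) ∧
    (∀ (n m : ℕ) (p : Fin n → Fin m → ℝ) (Y : Fin m → ℝ),
      (∀ i j, 0 ≤ p i j) → (∀ j, 0 ≤ Y j) → (∀ j, ∃ i, 0 < p i j) →
      (∀ i, ∃ j, 0 < Y j * p i j) →
      GradientLogConvex (petObjective p Y)) ∧
    (∀ (n m : ℕ) (a : Fin m → Fin n → ℝ),
      Submodule.span ℝ (Set.range a) = ⊤ → (∀ i, a i ≠ 0) →
      GradientLogConvex (dOptObjective a)) := by
  refine ⟨fun W _ _ _ _ E => ⟨fun y hy => ⟨E.det_pos hy,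
      (E.hasFDerivAt_logDet hy).differentiableAt, E.inner_gradient_logDet hy⟩,
    fun w hw => ⟨fun hw0 y hy => ?_, E.convexOn_log_inner_gradient hw,
      E.convexOn_log_tr_inv_mul hw⟩,
    fun n A => E.gradientLogConvex_logDet_comp A⟩,
    fun n m p Y => gradientLogConvex_petObjective, fun n m a => gradientLogConvex_dOptObjective⟩
  have hpos := E.tr_inv_mul_pos hw hw0 hy
  refine ⟨?_, hpos⟩
  rw [E.inner_gradient_logDet hy]
  exact mul_pos (inv_pos.2 (Nat.cast_pos.2 E.rank_pos)) hpos
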